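/- **Setting.** Fix $0<q<1$ and put $a=2|\ln q|$. For $x=(x^1,x^2,x^3)\in\mathbb Z^3$ let $l(x)=x^1+x^2+x^3$. The infinite stick is the set of points $\dots,-e_2-e_3,\,-e_3,\,0,\,e_1,\,e_1+e_2,\,e_1+e_2+e_3,\,e_1+e_2+e_3+e_1,\dots$; for an even integer $L\ge 0$ let $\Sigma$ be the set of its points with $-L/2\le l\le L/2$. A cylinder of length $L+1$ with finite base $\Gamma\subset\{x\in\mathbb Z^3:l(x)=0\}$ is $\{x+y: x\in\Gamma,\ y\in\Sigma\}$; it has $|\Gamma|(L+1)$ sites. For a finite $\Lambda\subset\mathbb Z^3$ let $\mathcal H_\Lambda=(\mathbb C^2)^{\otimes\Lambda}$, with orthonormal basis $|\alpha\rangle$, $\alpha\in\{0,1\}^\Lambda$ ($0=\,\uparrow$, $1=\,\downarrow$), let $\mathsf N|\alpha\rangle=\big(\sum_x\alpha(x)\big)|\alpha\rangle$, and let $S^{(3)}_x$ be the operator with value $\tfrac12$ on $\uparrow$ and $-\tfrac12$ on $\downarrow$ at $x$. The XXZ Hamiltonian (with anisotropy $\Delta=(q+q^{-1})/2$ and kink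 boundary terms) is $H_\Lambda=\sum h_{x_0,x_1}$, the sum over pairs $x_0,x_1\in\Lambda$ with $|x_0-x_1|=1$, $l(x_1)=l(x_0)+1$, where $h_{x_0,x_1}$ is the orthogonal projection onto $(1+q^2)^{-1/2}\big(q|\!\downarrow\uparrow\rangle-|\!\uparrow\downarrow\rangle\big)$ at $(x_0,x_1)$. Its ground states are the vectors of $\ker H_\Lambda$. The canonical and grand canonical ground states are $$\psi_0(\Lambda,n)=\sum_{\alpha:\ \sum_x\alpha(x)=n}\ \bigotimes_{x\in\Lambda}q^{l(x)\alpha(x)}|\alpha(x)\rangle,\qquad \psi^{GC}(\Lambda,\mu)=\bigotimes_{x\in\Lambda}\big(|\!\uparrow\rangle+q^{l(x)-\mu}|\!\downarrow\rangle\big),$$ and $\langle X\rangle_{\Lambda,n}$, $\langle X\rangle^{GC}_{\Lambda,\mu}$ denote the expectations $\langle\psi|X|\psi\rangle/\langle\psi|\psi\rangle$ in these vectors. For an operator $X$ on $\mathcal H_{\Lambda_0}$, $\|X\|_{gs}$ denotes either of the following two quantities: the norm $\|PXP\|$, where $P$ is the orthogonal projection onto $\ker H_{\Lambda_0}$, or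 $\sup_{0\le n_0\le|\Lambda_0|}|\langle X\rangle_{\Lambda_0,n_0}|$. **Theorem (Equivalence of Ensembles).** Let $\Lambda_0\subset\Lambda$ be two cylinders of the same length $L+1$, with bases of $A_0$ and $A$ sites, so that $|\Lambda_0|=A_0(L+1)$ and $|\Lambda|=A(L+1)$. Fix a particle number $n$ with $0<n<|\Lambda|$ and put $\rho=n/|\Lambda|$. Then the equation $$\langle\mathsf N\rangle^{GC}_{\Sigma,\mu}=\rho(L+1)$$ has exactly one solution $\mu\in\mathbb R$; if $\rho=1/2$, then $\mu=0$. Suppose moreover that $2A_0<q^2(A-A_0)^{1/2}$ (in particular $A_0<A$). Then for every operator $X$ on $\mathcal H_{\Lambda_0}$ that, regarded as the local observable $X\otimes 1$ on $\mathcal H_\Lambda$, commutes with $J^{(3)}=\sum_{x\in\Lambda}S^{(3)}_x$, $$\big|\langle X\rangle_{\Lambda,n}-\langle X\rangle^{GC}_{\Lambda_0,\mu}\big|\le\varepsilon\,\|X\|_{gs},$$ for both meanings of $\|X\|_{gs}$, where $$\varepsilon=\frac{\ln^2(A-A_0)+2(1+a^2)A_0^2+4}{2(A-A_0)}+\frac{4A_0}{q^2(A-A_0)^{1/2}-2A_0}.$$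 -/

import Mathlib

namespace XXZ

noncomputable section

/-! ### Geometry of cylindrical volumes in `ℤ³` -/

/-- Sites of the lattice `ℤ³`; the coordinates are indexed by `0, 1, 2`. -/
abbrev Site : Type := Fin 3 → ℤ

/-- The signed distance `l(x) = x¹ + x² + x³`. -/
def height (x : Site) : ℤ := x 0 + x 1 + x 2

/-- The point at height `m` of the infinite stick
`…, -e₂-e₃, -e₃, 0, e₁, e₁+e₂, e₁+e₂+e₃, e₁+e₂+e₃+e₁, …`
(integer division rounds down here). -/
def stickPoint (m : ℤ) : Site := ![(m + 2) / 3, (m + 1) / 3, m / 3]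

/-- The finite stick `Σ₀ = {x in the infinite stick : -L/2 ≤ l(x) ≤ L/2}`, used for even `L`. -/
def stick (L : ℕ) : Finset Site :=
  (Finset.Icc (-((L / 2 : ℕ) : ℤ)) ((L / 2 : ℕ) : ℤ)).image stickPoint

/-- The cylinder `{x + y : x ∈ Γ, y ∈ Σ₀}` with base `Γ`. -/
def cylinder (Γ : Finset Site) (L : ℕ) : Finset Site :=
  Finset.image₂ (fun x y => x + y) Γ (stick L)

/-- Oriented nearest-neighbour bonds `(x, y)`: `|x - y| = 1` and `l(y) = l(x) + 1`. -/
def IsBond (x y : Site) : Prop := ∃ i : Fin 3, y = x + Pi.single i 1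

/-! ### The Hilbert space and its operators -/

/-- Particle configurations on `Λ`: `0` is spin up (empty), `1` is spin down (occupied). -/
abbrev Conf (Λ : Finset Site) : Type := ↥Λ → Fin 2

/-- The Hilbert space `(ℂ²)^{⊗Λ}`, in the orthonormal basis of particle configurations. -/
abbrev Hilb (Λ : Finset Site) : Type := EuclideanSpace ℂ (Conf Λ)

/-- Number of particles of a configuration. -/
def count {Λ : Finset Site} (α : Conf Λ) : ℕ := ∑ x, (α x : ℕ)

/-- The operator that is diagonal in the configuration basis, with the given diagonal. -/
def diagOp {Λ : Finset Site} (f : Conf Λ → ℂ) : Hilb Λ →L[ℂ] Hilb Λ :=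
  Matrix.toEuclideanCLM (𝕜 := ℂ) (Matrix.diagonal f)

/-- The particle number operator. -/
def numberOp (Λ : Finset Site) : Hilb Λ →L[ℂ] Hilb Λ := diagOp fun α => (count α : ℂ)

/-- The third spin component at the site `x`: `1/2` on spin up, `-1/2` on spin down. -/
def spinZ {Λ : Finset Site} (x : ↥Λ) : Hilb Λ →L[ℂ] Hilb Λ :=
  diagOp fun α => if α x = 0 then 1 / 2 else -(1 / 2)

/-- The third component of the total spin. -/
def totalSpinZ (Λ : Finset Site) : Hilb Λ →L[ℂ] Hilb Λ := ∑ x : ↥Λ, spinZ x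

/-- Components of the unit vector `ξ = (1+q²)^{-1/2} (q |↓↑⟩ - |↑↓⟩)` on a bond. -/
def xi (q : ℝ) (s t : Fin 2) : ℝ :=
  if s = 1 ∧ t = 0 then q / √(1 + q ^ 2)
  else if s = 0 ∧ t = 1 then -(1 / √(1 + q ^ 2))
  else 0

/-- The operator `1 ⊗ |ξ⟩⟨ξ|`, with `|ξ⟩⟨ξ|` acting on the pair of sites `(x, y)`. -/
def bondOp (q : ℝ) {Λ : Finset Site} (x y : ↥Λ) : Hilb Λ →L[ℂ] Hilb Λ :=
  LinearMap.toContinuousLinearMap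
    { toFun := fun ψ => WithLp.toLp 2 fun α =>
        (xi q (α x) (α y) : ℂ) *
          ∑ s : Fin 2, ∑ t : Fin 2,
            (xi q s t : ℂ) * ψ (Function.update (Function.update α x s) y t)
      map_add' := fun ψ φ => by
        ext α
        simp only [PiLp.add_apply, mul_add, Finset.sum_add_distrib]
      map_smul' := fun c ψ => by
        ext α
        simp only [PiLp.smul_apply, smul_eq_mul, RingHom.id_apply, Finset.mul_sum]
        refine Finset.sum_congr rfl fun s _ => Finset.sum_congr rfl fun t _ => ?_
        ring }

open Classical in
/-- The XXZ Hamiltonian with kink boundary terms: the sum over the oriented bonds in `Λ` of the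
projections onto `ξ`. -/
def hamiltonian (q : ℝ) (Λ : Finset Site) : Hilb Λ →L[ℂ] Hilb Λ :=
  ∑ x : ↥Λ, ∑ y : ↥Λ, if IsBond x.1 y.1 then bondOp q x y else 0

/-- The ground-state subspace. The Hamiltonian is a sum of projections that all annihilate the
all-spins-up vector, so its lowest eigenvalue is `0`. -/
def groundSpace (q : ℝ) (Λ : Finset Site) : Submodule ℂ (Hilb Λ) :=
  LinearMap.ker (hamiltonian q Λ : Hilb Λ →ₗ[ℂ] Hilb Λ)

/-! ### Canonical and grand canonical ground states -/

/-- The canonical ground state `ψ₀(Λ, n) = ∑_{α : N(α) = n} ⨂_x q^{l(x) α(x)} |α(x)⟩`. -/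
def psi (q : ℝ) (Λ : Finset Site) (n : ℕ) : Hilb Λ :=
  WithLp.toLp 2 fun α =>
    if count α = n then ((∏ x, q ^ (height x.1 * ((α x : ℕ) : ℤ)) : ℝ) : ℂ) else 0

/-- The grand canonical vector `⨂_x (|↑⟩ + q^{l(x) - μ} |↓⟩)`. -/
def psiGC (q : ℝ) (Λ : Finset Site) (μ : ℝ) : Hilb Λ :=
  WithLp.toLp 2 fun α =>
    ((∏ x, (if α x = 0 then 1 else q ^ ((height x.1 : ℝ) - μ)) : ℝ) : ℂ)

/-- The expectation `⟨ψ|X|ψ⟩ / ⟨ψ|ψ⟩`. -/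
def expect {Λ : Finset Site} (ψ : Hilb Λ) (X : Hilb Λ →L[ℂ] Hilb Λ) : ℂ :=
  inner ℂ ψ (X ψ) / inner ℂ ψ ψ

/-- The canonical expectation `⟨X⟩_{Λ,n}`. -/
def canExp (q : ℝ) (Λ : Finset Site) (n : ℕ) (X : Hilb Λ →L[ℂ] Hilb Λ) : ℂ :=
  expect (psi q Λ n) X

/-- The grand canonical expectation `⟨X⟩^{GC}_{Λ,μ}`. -/
def gcExp (q : ℝ) (Λ : Finset Site) (μ : ℝ) (X : Hilb Λ →L[ℂ] Hilb Λ) : ℂ :=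
  expect (psiGC q Λ μ) X

/-! ### Local observables -/

/-- Replace the configuration `β` on `Λ` by `γ` inside `Λ₀`. -/
def override {Λ₀ Λ : Finset Site} (β : Conf Λ) (γ : Conf Λ₀) : Conf Λ :=
  fun x => if h : x.1 ∈ Λ₀ then γ ⟨x.1, h⟩ else β x

/-- Restriction of a configuration to a subvolume. -/
def restrict {Λ₀ Λ : Finset Site} (h : Λ₀ ⊆ Λ) (β : Conf Λ) : Conf Λ₀ :=
  fun x => β ⟨x.1, h x.2⟩

/-- For fixed values of `β` outside `Λ₀`, a vector on `Λ` as a vector on `Λ₀`. -/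
def slice {Λ₀ Λ : Finset Site} (β : Conf Λ) (ψ : Hilb Λ) : Hilb Λ₀ :=
  WithLp.toLp 2 fun γ => ψ (override β γ)

/-- The observable `X` on `Λ₀` as the observable `X ⊗ 1` on the larger volume `Λ`. -/
def ampliation {Λ₀ Λ : Finset Site} (h : Λ₀ ⊆ Λ) (X : Hilb Λ₀ →L[ℂ] Hilb Λ₀) :
    Hilb Λ →L[ℂ] Hilb Λ :=
  LinearMap.toContinuousLinearMap
    { toFun := fun ψ => WithLp.toLp 2 fun β => X (slice β ψ) (restrict h β)
      map_add' := fun ψ φ => by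
        ext β
        have : slice (Λ₀ := Λ₀) β (ψ + φ) = slice β ψ + slice β φ := by
          ext γ; simp [slice]
        simp [this]
      map_smul' := fun c ψ => by
        ext β
        have : slice (Λ₀ := Λ₀) β (c • ψ) = c • slice β ψ := by
          ext γ; simp [slice]
        simp [this] }

/-! ### The ground-state norm -/

/-- The operator norm of `X` restricted, as a form, to the ground-state subspace:
`‖P X P‖`, with `P` the orthogonal projection onto the ground-state subspace. -/
def gsNorm (q : ℝ) {Λ : Finset Site} (X : Hilb Λ →L[ℂ] Hilb Λ) : ℝ :=
  ‖(groundSpace q Λ).starProjection ∘L X ∘L (groundSpace q Λ).starProjection‖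

/-- The other form of the ground-state norm, for `X` that commutes with the total third spin
component: `sup_{0 ≤ n ≤ |Λ|} |⟨X⟩_{Λ,n}|`. -/
def gsSup (q : ℝ) {Λ : Finset Site} (X : Hilb Λ →L[ℂ] Hilb Λ) : ℝ :=
  ⨆ n : Fin (Λ.card + 1), ‖canExp q Λ n X‖

/-! ### The error term -/

/-- The error `ε`, for cross-sections of `A₀` and `A` sites. -/
def eps (q : ℝ) (A₀ A : ℕ) : ℝ :=
  (Real.log ((A : ℝ) - A₀) ^ 2 + 2 * (1 + (2 * |Real.log q|) ^ 2) * (A₀ : ℝ) ^ 2 + 4)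
      / (2 * ((A : ℝ) - A₀))
    + 4 * A₀ / (q ^ 2 * √((A : ℝ) - A₀) - 2 * A₀)

/-- The equation `⟨N⟩^{GC}_{Σ,μ} = ρ (L + 1)` for the chemical potential. -/
def IsChemPot (q : ℝ) (L : ℕ) (ρ μ : ℝ) : Prop :=
  gcExp q (stick L) μ (numberOp (stick L)) = ((ρ * ((L : ℝ) + 1) : ℝ) : ℂ)

end

end XXZ

open Polynomial

namespace XXZ

noncomputable section

/-! In the grand canonical state the occupation numbers are independent Bernoulli variables whose
parameter depends only on the height. The particle numbers N₀ on Λ₀, N₁ on Λ \ Λ₀ and N = N₀ + N₁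
therefore have Poisson binomial laws, encoded by `bernoulliPoly`, and conditioning on N = n gives
the canonical state. Hence ⟨X⟩_{Λ,n} is the average of the ⟨X⟩_{Λ₀,k} with weights P(N₀ = k) P(N₁ =
n - k) / P(N = n) (`canExp_ampliation_mul`), while for a number-conserving X the grand canonical
expectation has weights P(N₀ = k) (`gcExp_eq_sum`). Since each ⟨X⟩_{Λ₀,k} is bounded by either
ground-state norm, it remains to show ∑ₖ P(N₀ = k) |P(N₁ = n - k) - P(N = n)| ≤ ε P(N = n).

Write V₀, V₁ for the variances of N₀, N₁. The number P(N = n) is the mean, under the law of N₀, of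
the function k ↦ P(N₁ = n - k), which by Fourier analysis has Lipschitz constant O(1/V₁). So the sum
is O(√V₀ / V₁). The choice of μ makes n the mean of N, and log-concavity then bounds P(N = n) below
by a constant over the standard deviation; Chebyshev's inequality replaces this when the variance is
small. The outcome is the bound 4 √(V₀/V₁) (`sum_coeff_mul_abs_sub_le`).

Both variances are multiples of the variance of a single stick, so V₀/V₁ = A₀/(A - A₀), uniformly in
L and ρ. If √(A - A₀) > 4A₀, the bound lies below the second summand of ε; otherwise that summand is
at least 2 and the triangle inequality suffices. The first summand of ε is only used to be
nonnegative. -/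

/-- The generating polynomial of a sum of independent Bernoulli variables with parameters `p`. -/
def bernoulliPoly {ι : Type*} (s : Finset ι) (p : ι → ℝ) : ℝ[X] :=
  ∏ i ∈ s, (C (1 - p i) + C (p i) * X)

/-! ### Moments of Poisson binomial laws -/

/-- The linear functional `P ↦ ∑ₖ φ(k) Pₖ` on polynomials. -/
def coeffSum (φ : ℕ → ℝ) : ℝ[X] →ₗ[ℝ] ℝ :=
  Polynomial.lsum fun k => φ k • LinearMap.id

theorem coeffSum_eq_sum_range (φ : ℕ → ℝ) (P : ℝ[X]) {N : ℕ} (h : P.natDegree < N) :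
    coeffSum φ P = ∑ k ∈ Finset.range N, P.coeff k * φ k := by
  unfold coeffSum
  rw [Polynomial.lsum_apply, Polynomial.sum_over_range' _ _ N h]
  · exact Finset.sum_congr rfl fun k _ => by simp [mul_comm]
  · intro k; simp

/-- One more trial either keeps the number of successes or raises it by one. The moment formulas
follow from this recursion by induction on the set of trials. -/
theorem coeffSum_mul_linear (φ : ℕ → ℝ) (P : ℝ[X]) (a b : ℝ) :
    coeffSum φ (P * (C a + C b * X)) =
      a * coeffSum φ P + b * coeffSum (fun k => φ (k + 1)) P := by
  induction P using Polynomial.induction_on' with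
  | add P Q hP hQ => rw [add_mul, map_add, hP, hQ, map_add, map_add]; ring
  | monomial n c =>
    have : monomial n c * (C a + C b * X) = monomial n (c * a) + monomial (n + 1) (c * b) := by
      rw [mul_add, monomial_mul_C, ← mul_assoc, monomial_mul_C, monomial_mul_X]
    rw [this, map_add]
    simp only [coeffSum, Polynomial.lsum_apply]
    rw [sum_monomial_index _ _ (by simp), sum_monomial_index _ _ (by simp),
      sum_monomial_index _ _ (by simp), sum_monomial_index _ _ (by simp)]
    simp
    ring

section moments

variable {ι : Type*} [DecidableEq ι] (s : Finset ι) (p : ι → ℝ)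

theorem bernoulliPoly_insert {i : ι} (hi : i ∉ s) :
    bernoulliPoly (insert i s) p = bernoulliPoly s p * (C (1 - p i) + C (p i) * X) := by
  rw [bernoulliPoly, Finset.prod_insert hi, mul_comm, bernoulliPoly]

theorem coeffSum_one_bernoulliPoly : coeffSum (fun _ => 1) (bernoulliPoly s p) = 1 := by
  induction s using Finset.induction_on with
  | empty => rw [coeffSum_eq_sum_range _ _ (N := 1) (by simp [bernoulliPoly])]; simp [bernoulliPoly]
  | insert i s hi ih => rw [bernoulliPoly_insert s p hi, coeffSum_mul_linear, ih]; ring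

theorem coeffSum_add_const (φ : ℕ → ℝ) (c : ℝ) (P : ℝ[X]) :
    coeffSum (fun k => φ k + c) P = coeffSum φ P + c * coeffSum (fun _ => 1) P := by
  simp only [coeffSum_eq_sum_range _ P (Nat.lt_succ_self _), Finset.mul_sum,
    ← Finset.sum_add_distrib]
  exact Finset.sum_congr rfl fun k _ => by ring

theorem coeffSum_id_bernoulliPoly :
    coeffSum (fun k => (k : ℝ)) (bernoulliPoly s p) = ∑ i ∈ s, p i := by
  induction s using Finset.induction_on with
  | empty => rw [coeffSum_eq_sum_range _ _ (N := 1) (by simp [bernoulliPoly])]; simp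
  | insert i s hi ih =>
    rw [bernoulliPoly_insert s p hi, coeffSum_mul_linear, ih, Finset.sum_insert hi]
    push_cast
    rw [coeffSum_add_const, ih, coeffSum_one_bernoulliPoly]
    ring

theorem coeffSum_sq_bernoulliPoly (c : ℝ) :
    coeffSum (fun k => ((k : ℝ) - c) ^ 2) (bernoulliPoly s p) =
      ∑ i ∈ s, p i * (1 - p i) + (∑ i ∈ s, p i - c) ^ 2 := by
  induction s using Finset.induction_on generalizing c with
  | empty => rw [coeffSum_eq_sum_range _ _ (N := 1) (by simp [bernoulliPoly])]; simp [bernoulliPoly]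
  | insert i s hi ih =>
    rw [bernoulliPoly_insert s p hi, coeffSum_mul_linear, ih, Finset.sum_insert hi,
      Finset.sum_insert hi]
    have : (fun k : ℕ => (((k + 1 : ℕ) : ℝ) - c) ^ 2) = fun k : ℕ => ((k : ℝ) - (c - 1)) ^ 2 := by
      ext k; push_cast; ring
    rw [this, ih]
    ring

end moments

theorem natDegree_bernoulliPoly_le {ι : Type*} (s : Finset ι) (p : ι → ℝ) :
    (bernoulliPoly s p).natDegree ≤ s.card := by
  refine (natDegree_prod_le _ _).trans ?_
  rw [Finset.card_eq_sum_ones]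
  refine Finset.sum_le_sum fun i _ => ?_
  compute_degree

/-! ### Log-concavity -/

/-- A nonnegative log-concave sequence without internal zeros. -/
def IsLogConcave (c : ℕ → ℝ) : Prop :=
  (∀ k, 0 ≤ c k) ∧ ∀ i j, i ≤ j → c i * c (j + 2) ≤ c (i + 1) * c (j + 1)

theorem coeff_mul_linear_zero (P : ℝ[X]) (a b : ℝ) :
    (P * (C a + C b * X)).coeff 0 = P.coeff 0 * a := by
  simp [mul_coeff_zero]

theorem coeff_mul_linear_succ (P : ℝ[X]) (a b : ℝ) (k : ℕ) :
    (P * (C a + C b * X)).coeff (k + 1) = P.coeff (k + 1) * a + P.coeff k * b := by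
  rw [mul_add, ← mul_assoc]
  simp

/-- Compare coefficients of a², ab and b². In the mixed term one product cancels and what remains
moves two steps inwards, which is why log-concavity is stated for pairs i ≤ j and not only for i =
j. -/
theorem IsLogConcave.mul_linear {P : ℝ[X]} (h : IsLogConcave P.coeff) {a b : ℝ}
    (ha : 0 ≤ a) (hb : 0 ≤ b) : IsLogConcave (P * (C a + C b * X)).coeff := by
  obtain ⟨h0, hc⟩ := h
  refine ⟨fun k => ?_, fun i j hij => ?_⟩
  · cases k with
    | zero => rw [coeff_mul_linear_zero]; exact mul_nonneg (h0 _) ha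
    | succ k =>
      rw [coeff_mul_linear_succ]
      exact add_nonneg (mul_nonneg (h0 _) ha) (mul_nonneg (h0 _) hb)
  · cases i with
    | zero =>
      rw [coeff_mul_linear_zero, coeff_mul_linear_succ, coeff_mul_linear_succ,
        coeff_mul_linear_succ]
      have e1 := mul_le_mul_of_nonneg_left (hc 0 j hij) (mul_nonneg ha ha)
      have e2 := mul_nonneg (mul_nonneg (h0 0) (h0 j)) (mul_nonneg hb hb)
      have e3 := mul_nonneg (mul_nonneg (h0 1) (h0 j)) (mul_nonneg ha hb)
      simp only [zero_add] at *
      nlinarith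
    | succ i =>
      rw [coeff_mul_linear_succ, coeff_mul_linear_succ, coeff_mul_linear_succ,
        coeff_mul_linear_succ]
      have e1 := mul_le_mul_of_nonneg_left (hc (i + 1) j hij) (mul_nonneg ha ha)
      obtain ⟨j, rfl⟩ : ∃ j', j = j' + 1 := ⟨j - 1, by omega⟩
      have e2 := mul_le_mul_of_nonneg_left (hc i j (by omega)) (mul_nonneg hb hb)
      have e3 : P.coeff i * P.coeff (j + 1 + 2) ≤ P.coeff (i + 2) * P.coeff (j + 1) := by
        have f1 := hc i (j + 1) (by omega)
        rcases Nat.lt_or_ge i j with hlt | hge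
        · exact f1.trans (hc (i + 1) j (by omega))
        · obtain rfl : i = j := by omega
          linarith [f1]
      have e3' := mul_le_mul_of_nonneg_left e3 (mul_nonneg ha hb)
      have a1 : i + 1 + 1 = i + 2 := rfl
      have a2 : j + 1 + 1 = j + 2 := rfl
      have a3 : j + 1 + 2 = j + 3 := rfl
      simp only [a1, a2, a3] at *
      nlinarith

theorem isLogConcave_bernoulliPoly {ι : Type*} [DecidableEq ι] (s : Finset ι) (p : ι → ℝ)
    (hp : ∀ i, 0 < p i ∧ p i < 1) : IsLogConcave (bernoulliPoly s p).coeff := by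
  induction s using Finset.induction_on with
  | empty =>
    refine ⟨fun k => ?_, fun i j _ => ?_⟩
    · simp only [bernoulliPoly, Finset.prod_empty, coeff_one]; split_ifs <;> simp
    · simp [bernoulliPoly, coeff_one]
  | insert i s hi ih =>
    rw [bernoulliPoly_insert s p hi]
    exact ih.mul_linear (by linarith [hp i]) (hp i).1.le

theorem coeff_bernoulliPoly_nonneg {ι : Type*} [DecidableEq ι] (s : Finset ι) (p : ι → ℝ)
    (hp : ∀ i, 0 < p i ∧ p i < 1) (k : ℕ) : 0 ≤ (bernoulliPoly s p).coeff k :=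
  (isLogConcave_bernoulliPoly s p hp).1 k

theorem coeff_bernoulliPoly_pos {ι : Type*} [DecidableEq ι] (s : Finset ι) (p : ι → ℝ)
    (hp : ∀ i, 0 < p i ∧ p i < 1) {k : ℕ} (hk : k ≤ s.card) :
    0 < (bernoulliPoly s p).coeff k := by
  induction s using Finset.induction_on generalizing k with
  | empty => obtain rfl : k = 0 := by simpa using hk
             simp [bernoulliPoly]
  | insert i s hi ih =>
    rw [bernoulliPoly_insert s p hi]
    rw [Finset.card_insert_of_notMem hi] at hk
    have h1 : 0 < 1 - p i := by linarith [hp i]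
    cases k with
    | zero => rw [coeff_mul_linear_zero]; exact mul_pos (ih (by omega)) h1
    | succ k =>
      rw [coeff_mul_linear_succ]
      exact add_pos_of_nonneg_of_pos
        (mul_nonneg (coeff_bernoulliPoly_nonneg s p hp _) h1.le)
        (mul_pos (ih (by omega)) (hp i).1)

/-- A log-concave sequence lies below a geometric sequence touching it at a given point. -/
theorem IsLogConcave.exists_le_exp {c : ℕ → ℝ} (h : IsLogConcave c) {n : ℕ}
    (h0 : 0 < c n) (h1 : 0 < c (n + 1)) :
    ∃ x : ℝ, ∀ k, c k ≤ c n * Real.exp (x * ((k : ℝ) - n)) := by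
  -- Log-concavity makes successive ratios nonincreasing, so the ratio at n bounds the later ratios
  -- from above and the earlier ones from below.
  set θ := c (n + 1) / c n with hθ
  have hθ0 : 0 < θ := div_pos h1 h0
  have hup : ∀ j, c (n + j) ≤ c n * θ ^ j := by
    intro j
    induction j with
    | zero => simp
    | succ j ih =>
      have : c (n + (j + 1)) ≤ c (n + j) * θ := by
        rw [hθ, mul_div_assoc', le_div_iff₀ h0]
        cases j with
        | zero => simp [mul_comm]
        | succ j => have := h.2 n (n + j) (by omega)
                    simp only [← add_assoc] at *
                    linarith
      calc _ ≤ _ := this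
        _ ≤ c n * θ ^ j * θ := by gcongr
        _ = _ := by ring
  have hdown : ∀ j, j ≤ n → c (n - j) * θ ^ j ≤ c n := by
    intro j
    induction j with
    | zero => simp
    | succ j ih =>
      intro hj
      refine le_trans ?_ (ih (by omega))
      have : c (n - (j + 1)) * θ ≤ c (n - j) := by
        rw [hθ, mul_div_assoc', div_le_iff₀ h0]
        cases j with
        | zero => obtain ⟨m, rfl⟩ : ∃ m, n = m + 1 := ⟨n - 1, by omega⟩
                  have := h.2 m m le_rfl
                  simpa using this
        | succ j => obtain ⟨m, rfl⟩ : ∃ m, n = m + (j + 1 + 1) := ⟨n - (j + 1 + 1), by omega⟩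
                    have := h.2 m (m + (j + 1)) (by omega)
                    simp only [Nat.add_sub_cancel]
                    have e : m + (j + 1 + 1) - (j + 1) = m + 1 := by omega
                    rw [e]
                    simpa [add_assoc] using this
      calc _ = (c (n - (j + 1)) * θ) * θ ^ j := by ring
        _ ≤ _ := by gcongr
  refine ⟨Real.log θ, fun k => ?_⟩
  rcases le_total n k with hk | hk
  · obtain ⟨j, rfl⟩ := Nat.exists_eq_add_of_le hk
    have e : Real.exp (Real.log θ * (((n + j : ℕ) : ℝ) - n)) = θ ^ j := by
      rw [← Real.exp_log (pow_pos hθ0 j), Real.log_pow]; push_cast; congr 1; ring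
    rw [e]; exact hup j
  · obtain ⟨j, rfl⟩ := Nat.exists_eq_add_of_le hk
    have e : Real.exp (Real.log θ * ((k : ℝ) - (k + j : ℕ))) = (θ ^ j)⁻¹ := by
      rw [← Real.exp_log (inv_pos.2 (pow_pos hθ0 j)), Real.log_inv, Real.log_pow]
      push_cast; congr 1; ring
    rw [e, ← div_eq_mul_inv, le_div_iff₀ (pow_pos hθ0 j)]
    simpa using hdown j (by omega)

/-! ### Lower bounds for the probability of the mean -/

theorem card_int_le {S : Finset ℤ} {a b : ℝ} (hab : a ≤ b)
    (h : ∀ D ∈ S, a ≤ D ∧ (D : ℝ) ≤ b) : (S.card : ℝ) ≤ b - a + 1 := by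
  have hsub : S ⊆ Finset.Icc ⌈a⌉ ⌊b⌋ := fun D hD =>
    Finset.mem_Icc.2 ⟨Int.ceil_le.2 (h D hD).1, Int.le_floor.2 (h D hD).2⟩
  have h1 : (S.card : ℝ) ≤ ((Finset.Icc ⌈a⌉ ⌊b⌋).card : ℝ) := by
    exact_mod_cast Finset.card_le_card hsub
  refine h1.trans ?_
  rw [Int.card_Icc]
  rcases le_total 0 (⌊b⌋ + 1 - ⌈a⌉) with h0 | h0
  · have : (((⌊b⌋ + 1 - ⌈a⌉).toNat : ℤ) : ℝ) = ((⌊b⌋ + 1 - ⌈a⌉ : ℤ) : ℝ) := by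
      rw [Int.toNat_of_nonneg h0]
    rw [Int.cast_natCast] at this
    rw [this]
    push_cast
    linarith [Int.floor_le b, Int.le_ceil a]
  · rw [Int.toNat_of_nonpos h0]
    simp; linarith

/-- The sum telescopes against G(t) = (2 + xt) exp(-xt), for which -G'(t) = x (1 + xt) exp(-xt) and
G(0) = 2. -/
theorem sum_one_add_mul_exp_le {x : ℝ} (hx : 0 < x) (m : ℕ) :
    ∑ d ∈ Finset.range m, (1 + x * (d + 1)) * Real.exp (-(x * (d + 1))) ≤ 2 / x := by
  have key : ∀ d : ℕ, x * ((1 + x * (d + 1)) * Real.exp (-(x * (d + 1)))) ≤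
      (2 + x * d) * Real.exp (-(x * d)) -
        (2 + x * ((d + 1 : ℕ) : ℝ)) * Real.exp (-(x * ((d + 1 : ℕ) : ℝ))) := by
    intro d
    have he : Real.exp (-(x * d)) = Real.exp x * Real.exp (-(x * (d + 1))) := by
      rw [← Real.exp_add]; congr 1; ring
    push_cast
    rw [he, le_sub_iff_add_le]
    have hq := Real.quadratic_le_exp_of_nonneg hx.le
    have hE := Real.exp_pos (-(x * (d + 1)))
    have hd : (0 : ℝ) ≤ d := Nat.cast_nonneg d
    have h1 : x * (1 + x * (d + 1)) + (2 + x * (d + 1)) ≤ (2 + x * d) * Real.exp x := by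
      refine le_trans ?_ (mul_le_mul_of_nonneg_left hq (by positivity))
      have : 0 ≤ x ^ 3 * d := by positivity
      nlinarith
    calc _ = (x * (1 + x * (d + 1)) + (2 + x * (d + 1))) * Real.exp (-(x * (d + 1))) := by ring
      _ ≤ (2 + x * d) * Real.exp x * Real.exp (-(x * (d + 1))) := by gcongr
      _ = _ := by ring
  rw [le_div_iff₀ hx, mul_comm, Finset.mul_sum]
  refine (Finset.sum_le_sum fun d _ => key d).trans ?_
  rw [Finset.sum_range_sub' (fun d : ℕ => (2 + x * (d : ℝ)) * Real.exp (-(x * (d : ℝ))))]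
  have : 0 ≤ (2 + x * (m : ℝ)) * Real.exp (-(x * m)) := by positivity
  simp
  linarith

/-- Sum of a tilted truncated parabola over the integers. -/
theorem sum_tilted_parabola_le (S : Finset ℤ) {x r : ℝ} (hx : 0 ≤ x) (hr : 0 < r) :
    ∑ D ∈ S, max 0 (1 - x * D - D ^ 2 / r ^ 2) * Real.exp (x * D) ≤ 5 / 2 * r + 1 := by
  -- Each term is at most 1 because 1 - xD ≤ exp(-xD). So the sum is bounded by the number of
  -- integers at which the parabola is positive.
  have hterm : ∀ D : ℤ, max 0 (1 - x * D - D ^ 2 / r ^ 2) * Real.exp (x * D) ≤ 1 := by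
    intro D
    have h1 : max 0 (1 - x * D - D ^ 2 / r ^ 2) ≤ Real.exp (-(x * D)) := by
      refine max_le (Real.exp_pos _).le ?_
      have := Real.add_one_le_exp (-(x * D))
      have : 0 ≤ (D : ℝ) ^ 2 / r ^ 2 := by positivity
      linarith
    calc _ ≤ Real.exp (-(x * D)) * Real.exp (x * D) := by gcongr
      _ = 1 := by rw [← Real.exp_add]; simp
  have hsum : ∀ (U : Finset ℤ) (a b : ℝ), a ≤ b →
      (∀ D ∈ U, 0 < 1 - x * D - (D : ℝ) ^ 2 / r ^ 2 → a ≤ D ∧ (D : ℝ) ≤ b) →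
      ∑ D ∈ U, max 0 (1 - x * D - D ^ 2 / r ^ 2) * Real.exp (x * D) ≤ b - a + 1 := by
    intro U a b hab hU
    rw [← Finset.sum_filter_add_sum_filter_not U
      (fun D : ℤ => 0 < 1 - x * D - (D : ℝ) ^ 2 / r ^ 2)]
    have h2 : ∑ D ∈ U.filter (fun D : ℤ => ¬ 0 < 1 - x * D - (D : ℝ) ^ 2 / r ^ 2),
        max 0 (1 - x * D - D ^ 2 / r ^ 2) * Real.exp (x * D) = 0 := by
      refine Finset.sum_eq_zero fun D hD => ?_
      rw [max_eq_left (not_lt.1 (Finset.mem_filter.1 hD).2), zero_mul]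
    rw [h2, add_zero]
    refine (Finset.sum_le_card_nsmul _ _ 1 fun D _ => hterm D).trans ?_
    rw [nsmul_one]
    exact card_int_le hab fun D hD =>
      hU D (Finset.mem_filter.1 hD).1 (Finset.mem_filter.1 hD).2
  -- For a weak tilt the parabola is positive on an interval centred at -xr²/2 of half-length r √(1
  -- + (xr)²/4) ≤ 5r/4. For a strong tilt, counting gives 1/x + 1 for D ≥ 0, the exponential series
  -- gives 2/x for D < 0, and 3/x < 2r.
  rcases le_or_gt (x * r) (3 / 2) with hxr | hxr
  · refine (hsum S (-(x * r ^ 2 / 2) - 5 / 4 * r) (-(x * r ^ 2 / 2) + 5 / 4 * r)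
      (by linarith) fun D _ hD => ?_).trans (by linarith)
    have h1 : (D : ℝ) ^ 2 < (1 - x * D) * r ^ 2 := by
      rw [← div_lt_iff₀ (by positivity)]; linarith
    have h2 : ((D : ℝ) + x * r ^ 2 / 2) ^ 2 ≤ (5 / 4 * r) ^ 2 := by
      have h3 : (x * r) ^ 2 ≤ (3 / 2) ^ 2 := by gcongr
      have h4 := mul_le_mul_of_nonneg_right h3 (sq_nonneg r)
      nlinarith
    have h5 := abs_le_of_sq_le_sq' h2 (by positivity)
    constructor <;> linarith [h5.1, h5.2]
  · have hx0 : 0 < x := by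
      rcases hx.lt_or_eq with h | h
      · exact h
      · rw [← h] at hxr; norm_num at hxr
    rw [← Finset.sum_filter_add_sum_filter_not S (fun D : ℤ => 0 ≤ D)]
    have h1 := hsum (S.filter fun D : ℤ => 0 ≤ D) 0 (1 / x) (by positivity) (by
      intro D hD hpos
      have hD0 : (0 : ℝ) ≤ D := by exact_mod_cast (Finset.mem_filter.1 hD).2
      refine ⟨hD0, ?_⟩
      have : 0 ≤ (D : ℝ) ^ 2 / r ^ 2 := by positivity
      rw [le_div_iff₀ hx0]
      linarith)
    have h2 : ∑ D ∈ S with ¬ 0 ≤ D, max 0 (1 - x * D - (D : ℝ) ^ 2 / r ^ 2) * Real.exp (x * D)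
        ≤ 2 / x := by
      set U := S.filter fun D : ℤ => ¬ 0 ≤ D with hU
      have hneg : ∀ D ∈ U, D < 0 := fun D hD => not_le.1 (Finset.mem_filter.1 hD).2
      let g : ℤ → ℕ := fun D => (-D - 1).toNat
      have hg : ∀ D ∈ U, ((g D : ℕ) : ℝ) + 1 = -(D : ℝ) := by
        intro D hD
        have h0 : 0 ≤ -D - 1 := by have := hneg D hD; omega
        have : (((-D - 1).toNat : ℤ) : ℝ) = ((-D - 1 : ℤ) : ℝ) := by
          rw [Int.toNat_of_nonneg h0]
        rw [Int.cast_natCast] at this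
        simp only [g, this]; push_cast; ring
      have hinj : Set.InjOn g U := by
        intro D hD E hE hDE
        have h1 := hg D hD
        have h2 := hg E hE
        rw [hDE] at h1
        have : (D : ℝ) = E := by linarith
        exact_mod_cast this
      obtain ⟨m, hm⟩ : ∃ m, U.image g ⊆ Finset.range m := (U.image g).exists_nat_subset_range
      calc _ ≤ ∑ D ∈ U, (1 + x * ((g D : ℝ) + 1)) * Real.exp (-(x * ((g D : ℝ) + 1))) := by
            refine Finset.sum_le_sum fun D hD => ?_
            rw [hg D hD]
            have hD0 : (D : ℝ) < 0 := by exact_mod_cast hneg D hD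
            have e : -(x * -(D : ℝ)) = x * D := by ring
            rw [e]
            gcongr
            have := mul_pos_of_neg_of_neg (by linarith : -x < 0) hD0
            refine max_le (by linarith) ?_
            have : 0 ≤ (D : ℝ) ^ 2 / r ^ 2 := by positivity
            linarith
        _ = ∑ d ∈ U.image g, (1 + x * ((d : ℝ) + 1)) * Real.exp (-(x * ((d : ℝ) + 1))) := by
            rw [Finset.sum_image hinj]
        _ ≤ ∑ d ∈ Finset.range m, (1 + x * ((d : ℝ) + 1)) * Real.exp (-(x * ((d : ℝ) + 1))) :=
            Finset.sum_le_sum_of_subset_of_nonneg hm fun d _ _ => by positivity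
        _ ≤ _ := sum_one_add_mul_exp_le hx0 m
    have h3 : 3 / x ≤ 2 * r := by rw [div_le_iff₀ hx0]; linarith
    have h4 : 2 / x + 1 / x = 3 / x := by ring
    linarith

/-- Test w against 1 - xD - D²/r². The linear term has mean zero yet compensates the exponential
tilt of the majorant, so the tilt x disappears from the result. -/
theorem two_le_mul_of_le_exp_of_nonneg (S : Finset ℤ) (w : ℤ → ℝ) (hw : ∀ D ∈ S, 0 ≤ w D)
    (h1 : ∑ D ∈ S, w D = 1) (hmean : ∑ D ∈ S, w D * D = 0) {σ : ℝ} (hσ : 0 < σ)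
    (hvar : ∑ D ∈ S, w D * (D : ℝ) ^ 2 = σ ^ 2) {P x : ℝ} (hP : 0 ≤ P) (hx : 0 ≤ x)
    (hle : ∀ D ∈ S, w D ≤ P * Real.exp (x * D)) : 2 ≤ P * (13 * σ + 3) := by
  -- With r² = 3σ² the test function has mean 2/3, whence 2/3 ≤ P (5r/2 + 1). Multiplying by 3 and
  -- using √3 ≤ 26/15 gives the 13.
  set r := √3 * σ with hr
  have h3 : √3 ^ 2 = 3 := Real.sq_sqrt (by norm_num)
  have hr0 : 0 < r := by positivity
  have hr2 : r ^ 2 = 3 * σ ^ 2 := by rw [hr, mul_pow, h3]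
  have e1 : ∑ D ∈ S, w D * (1 - x * D - (D : ℝ) ^ 2 / r ^ 2) = 2 / 3 := by
    have : ∀ D ∈ S, w D * (1 - x * D - (D : ℝ) ^ 2 / r ^ 2) =
        w D - x * (w D * D) - (w D * (D : ℝ) ^ 2) / r ^ 2 := fun D _ => by ring
    rw [Finset.sum_congr rfl this, Finset.sum_sub_distrib, Finset.sum_sub_distrib,
      ← Finset.mul_sum, ← Finset.sum_div, h1, hmean, hvar, hr2]
    field_simp; norm_num
  have e2 : ∑ D ∈ S, w D * (1 - x * D - (D : ℝ) ^ 2 / r ^ 2) ≤ P * (5 / 2 * r + 1) := by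
    calc _ ≤ ∑ D ∈ S, P * (max 0 (1 - x * D - (D : ℝ) ^ 2 / r ^ 2) * Real.exp (x * D)) := by
          refine Finset.sum_le_sum fun D hD => ?_
          calc _ ≤ w D * max 0 (1 - x * D - (D : ℝ) ^ 2 / r ^ 2) :=
                mul_le_mul_of_nonneg_left (le_max_right _ _) (hw D hD)
            _ ≤ (P * Real.exp (x * D)) * max 0 (1 - x * D - (D : ℝ) ^ 2 / r ^ 2) :=
                mul_le_mul_of_nonneg_right (hle D hD) (le_max_left _ _)
            _ = _ := by ring
      _ = P * ∑ D ∈ S, max 0 (1 - x * D - (D : ℝ) ^ 2 / r ^ 2) * Real.exp (x * D) := by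
          rw [Finset.mul_sum]
      _ ≤ _ := mul_le_mul_of_nonneg_left (sum_tilted_parabola_le S hx hr0) hP
  have h4 : √3 ≤ 26 / 15 := Real.sqrt_le_iff.2 ⟨by norm_num, by norm_num⟩
  have h5 : r ≤ 26 / 15 * σ := mul_le_mul_of_nonneg_right h4 hσ.le
  have h6 := mul_le_mul_of_nonneg_left h5 hP
  nlinarith

/-- Lower bound for the central value of an integer-valued centred distribution that is dominated
by a geometric sequence through that value. -/
theorem two_le_mul_of_le_exp (S : Finset ℤ) (w : ℤ → ℝ) (hw : ∀ D ∈ S, 0 ≤ w D)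
    (h1 : ∑ D ∈ S, w D = 1) (hmean : ∑ D ∈ S, w D * D = 0) {σ : ℝ} (hσ : 0 < σ)
    (hvar : ∑ D ∈ S, w D * (D : ℝ) ^ 2 = σ ^ 2) {P x : ℝ} (hP : 0 ≤ P)
    (hle : ∀ D ∈ S, w D ≤ P * Real.exp (x * D)) : 2 ≤ P * (13 * σ + 3) := by
  rcases le_total 0 x with hx | hx
  · exact two_le_mul_of_le_exp_of_nonneg S w hw h1 hmean hσ hvar hP hx hle
  · have hinj : Set.InjOn (fun D : ℤ => -D) S := fun a _ b _ h => neg_injective h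
    refine two_le_mul_of_le_exp_of_nonneg (S.image fun D => -D) (fun D => w (-D)) ?_ ?_ ?_ hσ ?_
      hP (x := -x) (by linarith) ?_
    · intro D hD
      obtain ⟨E, hE, rfl⟩ := Finset.mem_image.1 hD
      simpa using hw E hE
    · rw [Finset.sum_image hinj]; simpa using h1
    · rw [Finset.sum_image hinj]; simpa using hmean
    · rw [Finset.sum_image hinj]; simpa using hvar
    · intro D hD
      obtain ⟨E, hE, rfl⟩ := Finset.mem_image.1 hD
      simpa using hle E hE

/-- Chebyshev's inequality on the integers: D² ≥ 1 away from 0. -/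
theorem one_sub_le_of_sum_sq (S : Finset ℤ) (w : ℤ → ℝ) (hw : ∀ D ∈ S, 0 ≤ w D)
    (h1 : ∑ D ∈ S, w D = 1) (h0 : 0 ≤ w 0) {V : ℝ}
    (hvar : ∑ D ∈ S, w D * (D : ℝ) ^ 2 = V) : 1 - V ≤ w 0 := by
  rw [← hvar, ← h1, ← Finset.sum_sub_distrib]
  calc ∑ D ∈ S, (w D - w D * (D : ℝ) ^ 2) ≤ ∑ D ∈ S, if D = 0 then w 0 else 0 := by
        refine Finset.sum_le_sum fun D hD => ?_
        split_ifs with h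
        · simp [h]
        · have h2 : (1 : ℝ) ≤ (D : ℝ) ^ 2 := by
            have : (1 : ℤ) ≤ D ^ 2 := by have := sq_pos_of_ne_zero h; omega
            exact_mod_cast this
          nlinarith [hw D hD]
    _ ≤ w 0 := by rw [Finset.sum_ite_eq']; split_ifs <;> simp [h0]

/-! ### Fourier bound for consecutive differences -/

theorem norm_coeff_le_integral (P : ℂ[X]) (n : ℕ) :
    ‖P.coeff n‖ ≤ 1 / (2 * Real.pi) *
      ∫ t in (0 : ℝ)..2 * Real.pi, ‖P.eval (Complex.exp (t * Complex.I))‖ := by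
  have : Fact (0 < 2 * Real.pi) := ⟨Real.two_pi_pos⟩
  rw [← fourierCoeff_toAddCircle_natCast, fourierCoeff_eq_intervalIntegral _ _ 0, norm_smul,
    zero_add, Real.norm_of_nonneg (by positivity)]
  gcongr
  refine (intervalIntegral.norm_integral_le_integral_norm (by positivity)).trans (le_of_eq ?_)
  refine intervalIntegral.integral_congr fun t _ => ?_
  have h1 : ((toAddCircle P) (t : AddCircle (2 * Real.pi))) =
      P.eval (Complex.exp (t * Complex.I)) := by
    have : ((AddCircle.toCircle (t : AddCircle (2 * Real.pi)) : Circle) : ℂ) =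
        Complex.exp (t * Complex.I) := by
      rw [AddCircle.toCircle_apply_mk, Circle.coe_exp]
      congr 2
      have := Real.pi_pos.ne'
      push_cast
      field_simp
    rw [toAddCircle, ← this, Polynomial.aeval_def, Polynomial.eval₂_eq_sum, Polynomial.eval_eq_sum,
      Polynomial.sum, Polynomial.sum]
    simp
  simp only [smul_eq_mul, norm_mul, h1, fourier_apply, Circle.norm_coe, one_mul]

theorem norm_sq_one_sub_exp (t : ℝ) :
    ‖1 - Complex.exp (t * Complex.I)‖ ^ 2 = 4 * Real.sin (t / 2) ^ 2 := by
  have h : (1 - Complex.exp (t * Complex.I)) =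
      ⟨1 - Real.cos t, -Real.sin t⟩ := by
    rw [Complex.exp_mul_I]
    apply Complex.ext <;> simp [Complex.cos_ofReal_re, Complex.sin_ofReal_re]
  rw [h, ← Complex.normSq_eq_norm_sq, Complex.normSq_mk]
  have h1 : Real.cos t = 1 - 2 * Real.sin (t / 2) ^ 2 := by
    have := Real.cos_sq' (t / 2)
    have h2 := Real.cos_two_mul (t / 2)
    rw [mul_div_cancel₀ t two_ne_zero] at h2
    linarith
  have h3 := Real.sin_sq_add_cos_sq t
  nlinarith

/-- The squared modulus is exactly 1 - 4p(1 - p) sin²(t/2); then use 1 + y ≤ exp y. -/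
theorem norm_bernoulli_charFun_le {p : ℝ} (t : ℝ) :
    ‖((1 - p : ℝ) : ℂ) + p * Complex.exp (t * Complex.I)‖ ≤
      Real.exp (-(2 * (p * (1 - p)) * Real.sin (t / 2) ^ 2)) := by
  have h : ((1 - p : ℝ) : ℂ) + p * Complex.exp (t * Complex.I) =
      ⟨1 - p + p * Real.cos t, p * Real.sin t⟩ := by
    rw [Complex.exp_mul_I]
    apply Complex.ext <;> simp [Complex.cos_ofReal_re, Complex.sin_ofReal_re]
  have h1 : Real.cos t = 1 - 2 * Real.sin (t / 2) ^ 2 := by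
    have := Real.cos_sq' (t / 2)
    have h2 := Real.cos_two_mul (t / 2)
    rw [mul_div_cancel₀ t two_ne_zero] at h2
    linarith
  have h3 := Real.sin_sq_add_cos_sq t
  refine (sq_le_sq₀ (norm_nonneg _) (Real.exp_pos _).le).1 ?_
  rw [h, ← Complex.normSq_eq_norm_sq, Complex.normSq_mk, ← Real.exp_nat_mul]
  have h4 := Real.add_one_le_exp (-(4 * (p * (1 - p)) * Real.sin (t / 2) ^ 2))
  have e : ((2 : ℕ) : ℝ) * -(2 * (p * (1 - p)) * Real.sin (t / 2) ^ 2) =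
    -(4 * (p * (1 - p)) * Real.sin (t / 2) ^ 2) := by push_cast; ring
  rw [e]
  refine le_trans (le_of_eq ?_) h4
  have h5 : Real.sin t ^ 2 = 1 - (1 - 2 * Real.sin (t / 2) ^ 2) ^ 2 := by rw [← h1]; linarith
  rw [h1]
  linear_combination p ^ 2 * h5

theorem integral_exp_neg_one_sub_sq_le {c : ℝ} (hc : 0 < c) :
    ∫ u in (0 : ℝ)..1, Real.exp (-(c * (1 - u ^ 2))) ≤ 17 / (24 * c) := by
  have hcont : Continuous fun u : ℝ => Real.exp (-(c * (1 - u ^ 2))) := by fun_prop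
  have hexp : ∀ (a b k l : ℝ), k ≠ 0 → ∫ u in a..b, Real.exp (k * u + l) =
      Real.exp (k * b + l) / k - Real.exp (k * a + l) / k := by
    intro a b k l hk
    have hd : ∀ u ∈ Set.uIcc a b, HasDerivAt (fun u => Real.exp (k * u + l) / k)
        (Real.exp (k * u + l)) u := by
      intro u _
      have h := ((((hasDerivAt_id u).const_mul k).add_const l).exp).div_const k
      rwa [mul_one, mul_div_cancel_right₀ _ hk] at h
    rw [intervalIntegral.integral_eq_sub_of_hasDerivAt hd
      (Continuous.intervalIntegrable (by fun_prop) _ _)]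
  rw [← intervalIntegral.integral_add_adjacent_intervals (b := 1 / 2)
    (hcont.intervalIntegrable _ _) (hcont.intervalIntegrable _ _)]
  -- On each half of [0, 1] the convex function u² is replaced by its chord, which makes the
  -- integrals explicit.
  have h1 : ∫ u in (0 : ℝ)..1 / 2, Real.exp (-(c * (1 - u ^ 2))) ≤
      ∫ u in (0 : ℝ)..1 / 2, Real.exp (c / 2 * u + -c) := by
    refine intervalIntegral.integral_mono_on (by norm_num) (hcont.intervalIntegrable _ _)
      (Continuous.intervalIntegrable (by fun_prop) _ _) fun u hu => ?_
    gcongr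
    have := mul_nonneg hu.1 (sub_nonneg.2 hu.2)
    nlinarith
  have h2 : ∫ u in (1 / 2 : ℝ)..1, Real.exp (-(c * (1 - u ^ 2))) ≤
      ∫ u in (1 / 2 : ℝ)..1, Real.exp (3 / 2 * c * u + -(3 / 2 * c)) := by
    refine intervalIntegral.integral_mono_on (by norm_num) (hcont.intervalIntegrable _ _)
      (Continuous.intervalIntegrable (by fun_prop) _ _) fun u hu => ?_
    gcongr
    have := mul_nonneg (sub_nonneg.2 hu.1) (sub_nonneg.2 hu.2)
    nlinarith
  rw [hexp _ _ _ _ (by positivity)] at h1 h2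
  refine (add_le_add h1 h2).trans ?_
  set w := Real.exp (-(c / 4)) with hw
  have e1 : Real.exp (c / 2 * (1 / 2) + -c) = w ^ 3 := by
    rw [hw, ← Real.exp_nat_mul]; congr 1; push_cast; ring
  have e2 : Real.exp (c / 2 * 0 + -c) = w ^ 4 := by
    rw [hw, ← Real.exp_nat_mul]; congr 1; push_cast; ring
  have e3 : Real.exp (3 / 2 * c * 1 + -(3 / 2 * c)) = 1 := by
    rw [mul_one, add_neg_cancel, Real.exp_zero]
  have e4 : Real.exp (3 / 2 * c * (1 / 2) + -(3 / 2 * c)) = w ^ 3 := by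
    rw [hw, ← Real.exp_nat_mul]; congr 1; push_cast; ring
  rw [e1, e2, e3, e4]
  have hw0 : 0 < w := Real.exp_pos _
  -- This product equals 17/24 - (2/3 + 4w³/3 - 2w⁴): the maximum is attained at w = 1/2, the source
  -- of the constant 17/24.
  have key : 0 ≤ (w - 1 / 2) ^ 2 * (2 * w ^ 2 + 2 / 3 * w + 1 / 6) := by positivity
  have : w ^ 3 / (c / 2) - w ^ 4 / (c / 2) + (1 / (3 / 2 * c) - w ^ 3 / (3 / 2 * c)) =
      (2 / 3 + 4 / 3 * w ^ 3 - 2 * w ^ 4) / c := by field_simp; ring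
  rw [this, div_le_div_iff₀ hc (by positivity)]
  have : 2 / 3 + 4 / 3 * w ^ 3 - 2 * w ^ 4 ≤ 17 / 24 := by nlinarith
  nlinarith

/-- Substituting u = -cos(t/2) absorbs the sine and turns sin²(t/2) into 1 - u². The sine vanishes
where the exponential is largest, so the decay is 1/V and not 1/√V. -/
theorem integral_sin_mul_exp_le {V : ℝ} (hV : 0 < V) :
    ∫ t in (0 : ℝ)..2 * Real.pi, Real.sin (t / 2) * Real.exp (-(2 * V * Real.sin (t / 2) ^ 2)) ≤
      17 / (12 * V) := by
  have hc : 0 < 2 * V := by positivity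
  have hg : Continuous fun u : ℝ => Real.exp (-(2 * V * (1 - u ^ 2))) := by fun_prop
  have hsub := intervalIntegral.integral_comp_mul_deriv (a := 0) (b := 2 * Real.pi)
    (f := fun t => -Real.cos (t / 2)) (f' := fun t => Real.sin (t / 2) / 2)
    (g := fun u => Real.exp (-(2 * V * (1 - u ^ 2))))
    (fun t _ => by
      have h := ((hasDerivAt_id t).div_const 2).cos.neg
      have e : -(-Real.sin (id t / 2) * (1 / 2)) = Real.sin (t / 2) / 2 := by simp only [id]; ring
      rw [e] at h
      exact h)
    (by fun_prop) hg
  have e0 : -Real.cos (0 / 2) = -1 := by simp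
  have e1 : -Real.cos (2 * Real.pi / 2) = 1 := by
    rw [mul_div_cancel_left₀ _ two_ne_zero]; simp
  simp only [e0, e1] at hsub
  have h1 : ∫ t in (0 : ℝ)..2 * Real.pi,
      Real.sin (t / 2) * Real.exp (-(2 * V * Real.sin (t / 2) ^ 2)) =
      2 * ∫ u in (-1 : ℝ)..1, Real.exp (-(2 * V * (1 - u ^ 2))) := by
    rw [← hsub, ← intervalIntegral.integral_const_mul]
    refine intervalIntegral.integral_congr fun t _ => ?_
    simp only [Function.comp, Real.sin_sq]
    ring_nf
  have h2 : ∫ u in (-1 : ℝ)..0, Real.exp (-(2 * V * (1 - u ^ 2))) =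
      ∫ u in (0 : ℝ)..1, Real.exp (-(2 * V * (1 - u ^ 2))) := by
    have := intervalIntegral.integral_comp_neg (a := (0 : ℝ)) (b := 1)
      fun u : ℝ => Real.exp (-(2 * V * (1 - u ^ 2)))
    simp only [neg_zero, even_two.neg_pow] at this
    exact this.symm
  rw [h1, ← intervalIntegral.integral_add_adjacent_intervals (b := 0)
    (hg.intervalIntegrable _ _) (hg.intervalIntegrable _ _), h2]
  have h3 := integral_exp_neg_one_sub_sq_le hc
  have e : 17 / (12 * V) = 4 * (17 / (24 * (2 * V))) := by field_simp; norm_num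
  rw [e]
  linarith

/-- Consecutive differences of a Poisson binomial distribution decay like the inverse variance. -/
theorem abs_coeff_one_sub_X_mul_bernoulliPoly_le {ι : Type*} (s : Finset ι) (p : ι → ℝ)
    {V : ℝ} (hV : ∑ i ∈ s, p i * (1 - p i) = V) (hV0 : 0 < V) (n : ℕ) :
    |((1 - X) * bernoulliPoly s p).coeff n| ≤ 17 / (12 * Real.pi * V) := by
  have h := norm_coeff_le_integral (((1 - X) * bernoulliPoly s p).map (algebraMap ℝ ℂ)) n
  rw [coeff_map, norm_algebraMap', Real.norm_eq_abs] at h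
  refine h.trans ?_
  -- The factor 1 - X contributes |1 - exp(it)| = 2 sin(t/2), the sine needed for the 1/V decay.
  have hbound : ∀ t ∈ Set.Icc (0 : ℝ) (2 * Real.pi),
      ‖(((1 - X) * bernoulliPoly s p).map (algebraMap ℝ ℂ)).eval (Complex.exp (t * Complex.I))‖ ≤
        2 * (Real.sin (t / 2) * Real.exp (-(2 * V * Real.sin (t / 2) ^ 2))) := by
    intro t ht
    have hs : 0 ≤ Real.sin (t / 2) := Real.sin_nonneg_of_nonneg_of_le_pi (by linarith [ht.1])
      (by linarith [ht.2])
    have e1 : ‖1 - Complex.exp (t * Complex.I)‖ = 2 * Real.sin (t / 2) := by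
      rw [← sq_eq_sq₀ (norm_nonneg _) (by positivity), norm_sq_one_sub_exp]; ring
    rw [Polynomial.map_mul, eval_mul, norm_mul, bernoulliPoly, Polynomial.map_prod, eval_prod,
      norm_prod]
    have e2 : (Polynomial.map (algebraMap ℝ ℂ) (1 - X)).eval (Complex.exp (t * Complex.I)) =
        1 - Complex.exp (t * Complex.I) := by simp
    rw [e2, e1, mul_assoc]
    gcongr
    have e3 : -(2 * V * Real.sin (t / 2) ^ 2) =
        ∑ i ∈ s, -(2 * (p i * (1 - p i)) * Real.sin (t / 2) ^ 2) := by
      rw [← hV, Finset.mul_sum, Finset.sum_mul, Finset.sum_neg_distrib]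
    rw [e3, Real.exp_sum]
    refine Finset.prod_le_prod (fun i _ => norm_nonneg _) fun i _ => ?_
    refine le_trans (le_of_eq ?_) (norm_bernoulli_charFun_le t)
    simp
  have h2 : ∫ t in (0 : ℝ)..2 * Real.pi,
      ‖(((1 - X) * bernoulliPoly s p).map (algebraMap ℝ ℂ)).eval (Complex.exp (t * Complex.I))‖ ≤
      2 * (17 / (12 * V)) := by
    refine (intervalIntegral.integral_mono_on (by positivity)
      (Continuous.intervalIntegrable (by fun_prop) _ _)
      (Continuous.intervalIntegrable (by fun_prop) _ _) hbound).trans ?_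
    rw [intervalIntegral.integral_const_mul]
    exact mul_le_mul_of_nonneg_left (integral_sin_mul_exp_le hV0) (by norm_num)
  refine (mul_le_mul_of_nonneg_left h2 (by positivity)).trans (le_of_eq ?_)
  have := Real.pi_pos.ne'
  field_simp

/-! ### Mean deviation of Lipschitz functions, and shifts -/

theorem sum_sum_mul_sub_sq {κ : Type*} (K : Finset κ) (a Y : κ → ℝ) (h1 : ∑ k ∈ K, a k = 1)
    (c : ℝ) :
    ∑ k ∈ K, ∑ j ∈ K, a k * a j * (Y k - Y j) ^ 2 =
      2 * ∑ k ∈ K, a k * (Y k - c) ^ 2 - 2 * (∑ k ∈ K, a k * (Y k - c)) ^ 2 := by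
  have e : ∀ k j, a k * a j * (Y k - Y j) ^ 2 = a j * (a k * (Y k - c) ^ 2) +
      a k * (a j * (Y j - c) ^ 2) - 2 * ((a k * (Y k - c)) * (a j * (Y j - c))) := by
    intro k j; ring
  simp only [e, Finset.sum_add_distrib, Finset.sum_sub_distrib, ← Finset.mul_sum,
    ← Finset.sum_mul, h1]
  ring

/-- The mean absolute deviation of a Lipschitz function is at most its Lipschitz constant times the
standard deviation. -/
theorem sum_mul_abs_sub_le_of_lipschitz (K : Finset ℕ) (a Y : ℕ → ℝ) (ha : ∀ k ∈ K, 0 ≤ a k)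
    (h1 : ∑ k ∈ K, a k = 1) {δ V c : ℝ} (hδ : 0 ≤ δ)
    (hY : ∀ k j, |Y k - Y j| ≤ δ * |(k : ℝ) - j|)
    (hV : ∑ k ∈ K, a k * ((k : ℝ) - c) ^ 2 ≤ V) :
    ∑ k ∈ K, a k * |Y k - ∑ j ∈ K, a j * Y j| ≤ δ * √V := by
  set m := ∑ j ∈ K, a j * Y j with hm
  have hV0 : 0 ≤ V := le_trans (Finset.sum_nonneg fun k hk => mul_nonneg (ha k hk) (sq_nonneg _)) hV
  have e1 := sum_sum_mul_sub_sq K a Y h1 m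
  have e2 := sum_sum_mul_sub_sq K a (fun k => (k : ℝ)) h1 c
  have e3 : ∑ k ∈ K, a k * (Y k - m) = 0 := by
    simp only [mul_sub, Finset.sum_sub_distrib, ← Finset.sum_mul, h1]
    rw [← hm]; ring
  rw [e3] at e1
  -- Writing variances as sums over pairs lets the Lipschitz condition act directly on differences;
  -- Cauchy–Schwarz then passes to the absolute deviation.
  have e4 : ∑ k ∈ K, ∑ j ∈ K, a k * a j * (Y k - Y j) ^ 2 ≤
      δ ^ 2 * ∑ k ∈ K, ∑ j ∈ K, a k * a j * ((k : ℝ) - j) ^ 2 := by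
    simp only [Finset.mul_sum]
    refine Finset.sum_le_sum fun k hk => Finset.sum_le_sum fun j hj => ?_
    have h2 : (Y k - Y j) ^ 2 ≤ (δ * |(k : ℝ) - j|) ^ 2 := by
      rw [← sq_abs (Y k - Y j)]
      gcongr
      exact hY k j
    rw [mul_pow, sq_abs] at h2
    have h3 := mul_le_mul_of_nonneg_left h2 (mul_nonneg (ha k hk) (ha j hj))
    linarith
  have e5 : (∑ k ∈ K, a k * |Y k - m|) ^ 2 ≤
      (∑ k ∈ K, a k) * ∑ k ∈ K, a k * (Y k - m) ^ 2 := by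
    refine Finset.sum_sq_le_sum_mul_sum_of_sq_le_mul K ha
      (fun k hk => mul_nonneg (ha k hk) (sq_nonneg _)) fun k _ => ?_
    rw [mul_pow, sq_abs]; exact le_of_eq (by ring)
  rw [h1, one_mul] at e5
  refine (sq_le_sq₀ (Finset.sum_nonneg fun k hk => mul_nonneg (ha k hk) (abs_nonneg _))
    (by positivity)).1 ?_
  rw [mul_pow, Real.sq_sqrt hV0]
  have h6 : 0 ≤ (∑ k ∈ K, a k * ((k : ℝ) - c)) ^ 2 := sq_nonneg _
  have h7 : ∑ k ∈ K, ∑ j ∈ K, a k * a j * ((k : ℝ) - j) ^ 2 ≤ 2 * V := by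
    rw [e2]; linarith
  have h8 := mul_le_mul_of_nonneg_left h7 (sq_nonneg δ)
  nlinarith

section shift

variable (P : ℝ[X]) (n : ℕ)

/-- The coefficient of X^k P at n is the coefficient of P at n - k, with value 0 for k > n, so
truncated subtraction is avoided. A unit step in k is, up to sign, a coefficient of (1 - X) P. -/
theorem abs_coeff_X_pow_mul_sub_le {δ : ℝ} (hδ : 0 ≤ δ)
    (h : ∀ m, |((1 - X) * P).coeff m| ≤ δ) (k j : ℕ) :
    |(X ^ k * P).coeff n - (X ^ j * P).coeff n| ≤ δ * |(k : ℝ) - j| := by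
  have hstep : ∀ k, |(X ^ (k + 1) * P).coeff n - (X ^ k * P).coeff n| ≤ δ := by
    intro k
    have : (X ^ (k + 1) * P).coeff n - (X ^ k * P).coeff n =
        -(X ^ k * ((1 - X) * P)).coeff n := by
      rw [← coeff_sub, ← coeff_neg]; congr 1; ring
    rw [this, abs_neg, coeff_X_pow_mul']
    split_ifs
    · exact h _
    · simpa using hδ
  have hup : ∀ k d : ℕ, |(X ^ (k + d) * P).coeff n - (X ^ k * P).coeff n| ≤ δ * d := by
    intro k d
    induction d with
    | zero => simp
    | succ d ih =>
      have := abs_sub_le ((X ^ (k + (d + 1)) * P).coeff n) ((X ^ (k + d) * P).coeff n)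
        ((X ^ k * P).coeff n)
      have h2 := hstep (k + d)
      rw [add_assoc] at h2
      push_cast
      linarith
  rcases le_total k j with hkj | hkj
  · obtain ⟨d, rfl⟩ := Nat.exists_eq_add_of_le hkj
    rw [abs_sub_comm, abs_sub_comm (k : ℝ)]
    simpa using hup k d
  · obtain ⟨d, rfl⟩ := Nat.exists_eq_add_of_le hkj
    simpa using hup j d

theorem coeff_mul_eq_sum_X_pow (Q : ℝ[X]) {N : ℕ} (hN : Q.natDegree < N) :
    (Q * P).coeff n = ∑ k ∈ Finset.range N, Q.coeff k * (X ^ k * P).coeff n := by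
  conv_lhs => rw [Q.as_sum_range' N hN, Finset.sum_mul, finsetSum_coeff]
  refine Finset.sum_congr rfl fun k _ => ?_
  rw [← C_mul_X_pow_eq_monomial, mul_assoc, coeff_C_mul]

end shift

/-! ### Conditioning on the total number of successes -/

section bernoulli

variable {ι : Type*} [DecidableEq ι] (s : Finset ι) (p : ι → ℝ)

theorem sum_coeff_bernoulliPoly :
    ∑ k ∈ Finset.range (s.card + 1), (bernoulliPoly s p).coeff k = 1 := by
  have := coeffSum_one_bernoulliPoly s p
  rw [coeffSum_eq_sum_range _ _ (Nat.lt_succ_of_le (natDegree_bernoulliPoly_le s p))] at this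
  simpa using this

theorem sum_coeff_bernoulliPoly_mul_sq (c : ℝ) :
    ∑ k ∈ Finset.range (s.card + 1), (bernoulliPoly s p).coeff k * ((k : ℝ) - c) ^ 2 =
      ∑ i ∈ s, p i * (1 - p i) + (∑ i ∈ s, p i - c) ^ 2 := by
  rw [← coeffSum_sq_bernoulliPoly,
    coeffSum_eq_sum_range _ _ (Nat.lt_succ_of_le (natDegree_bernoulliPoly_le s p))]

theorem sum_coeff_bernoulliPoly_mul_id :
    ∑ k ∈ Finset.range (s.card + 1), (bernoulliPoly s p).coeff k * (k : ℝ) = ∑ i ∈ s, p i := by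
  rw [← coeffSum_id_bernoulliPoly s p,
    coeffSum_eq_sum_range _ _ (Nat.lt_succ_of_le (natDegree_bernoulliPoly_le s p))]

/-- Lower bounds for a Poisson binomial distribution at its mean, when this is an integer. -/
theorem coeff_bernoulliPoly_mean_lower_bounds (hp : ∀ i, 0 < p i ∧ p i < 1) {n : ℕ}
    (hn : n < s.card) (hmean : ∑ i ∈ s, p i = n) {σ : ℝ} (hσ : 0 < σ)
    (hvar : ∑ i ∈ s, p i * (1 - p i) = σ ^ 2) :
    1 - σ ^ 2 ≤ (bernoulliPoly s p).coeff n ∧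
      2 ≤ (bernoulliPoly s p).coeff n * (13 * σ + 3) := by
  set c := (bernoulliPoly s p).coeff with hc
  let S : Finset ℤ := (Finset.range (s.card + 1)).image fun k : ℕ => (k : ℤ) - n
  let w : ℤ → ℝ := fun D => c (D + n).toNat
  have hinj : Set.InjOn (fun k : ℕ => (k : ℤ) - n) (Finset.range (s.card + 1)) := by
    intro a _ b _ h
    have h' : (a : ℤ) - n = b - n := h
    omega
  have hw : ∀ k : ℕ, w ((k : ℤ) - n) = c k := fun k => by simp [w]
  have hw0 : ∀ D, 0 ≤ w D := fun D => coeff_bernoulliPoly_nonneg s p hp _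
  have h1 : ∑ D ∈ S, w D = 1 := by
    rw [Finset.sum_image hinj]
    simp only [hw]
    exact sum_coeff_bernoulliPoly s p
  have hm : ∑ D ∈ S, w D * D = 0 := by
    rw [Finset.sum_image hinj]
    simp only [hw]
    push_cast
    simp only [mul_sub, Finset.sum_sub_distrib, ← Finset.sum_mul]
    rw [sum_coeff_bernoulliPoly, sum_coeff_bernoulliPoly_mul_id, hmean]
    ring
  have hv : ∑ D ∈ S, w D * (D : ℝ) ^ 2 = σ ^ 2 := by
    rw [Finset.sum_image hinj]
    simp only [hw]
    push_cast
    rw [sum_coeff_bernoulliPoly_mul_sq, hmean, hvar]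
    ring
  have hwn : w 0 = c n := by simp [w]
  constructor
  · rw [← hwn]
    exact one_sub_le_of_sum_sq S w (fun D _ => hw0 D) h1 (hw0 0) hv
  -- The strict inequality `hn` makes the coefficient at n + 1 positive too, so the tangent
  -- geometric sequence exists.
  · obtain ⟨x, hx⟩ := (isLogConcave_bernoulliPoly s p hp).exists_le_exp
      (coeff_bernoulliPoly_pos s p hp hn.le) (coeff_bernoulliPoly_pos s p hp (k := n + 1) hn)
    refine two_le_mul_of_le_exp S w (fun D _ => hw0 D) h1 hm hσ hv
      (coeff_bernoulliPoly_nonneg s p hp n) (x := x) fun D hD => ?_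
    obtain ⟨k, _, rfl⟩ := Finset.mem_image.1 hD
    rw [hw]
    push_cast
    exact hx k

theorem bernoulliPoly_mul_sdiff {s₀ : Finset ι} (h : s₀ ⊆ s) :
    bernoulliPoly s₀ p * bernoulliPoly (s \ s₀) p = bernoulliPoly s p := by
  rw [mul_comm]; exact Finset.prod_sdiff h

theorem coeff_bernoulliPoly_le_one (hp : ∀ i, 0 < p i ∧ p i < 1) (k : ℕ) :
    (bernoulliPoly s p).coeff k ≤ 1 := by
  rcases le_or_gt k s.card with hk | hk
  · rw [← sum_coeff_bernoulliPoly s p]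
    exact Finset.single_le_sum (f := fun k => (bernoulliPoly s p).coeff k)
      (fun k _ => coeff_bernoulliPoly_nonneg s p hp k) (Finset.mem_range.2 (by omega))
  · rw [coeff_eq_zero_of_natDegree_lt ((natDegree_bernoulliPoly_le s p).trans_lt hk)]
    exact zero_le_one

theorem abs_coeff_one_sub_X_mul_bernoulliPoly_le_one (hp : ∀ i, 0 < p i ∧ p i < 1) (n : ℕ) :
    |((1 - X) * bernoulliPoly s p).coeff n| ≤ 1 := by
  have h0 := coeff_bernoulliPoly_nonneg s p hp
  have h1 := coeff_bernoulliPoly_le_one s p hp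
  rw [sub_mul, one_mul, coeff_sub]
  cases n with
  | zero => simpa [abs_of_nonneg (h0 0)] using h1 0
  | succ n =>
    rw [coeff_X_mul, abs_le]
    constructor <;> linarith [h0 n, h1 n, h0 (n + 1), h1 (n + 1)]

/-- Conditioning on the total number of successes changes the distribution of a small part of the
trials only little, when the total number equals its mean. -/
theorem sum_coeff_mul_abs_sub_le (hp : ∀ i, 0 < p i ∧ p i < 1) {s₀ : Finset ι} (hs : s₀ ⊆ s)
    {n : ℕ} (hn : n < s.card) (hmean : ∑ i ∈ s, p i = n) {V₀ V₁ : ℝ}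
    (hV₀ : ∑ i ∈ s₀, p i * (1 - p i) = V₀) (hV₁ : ∑ i ∈ s \ s₀, p i * (1 - p i) = V₁)
    (hpos : 0 < V₁) (hle : 16 * V₀ ≤ V₁) :
    ∑ k ∈ Finset.range (s₀.card + 1), (bernoulliPoly s₀ p).coeff k *
        |(X ^ k * bernoulliPoly (s \ s₀) p).coeff n - (bernoulliPoly s p).coeff n| ≤
      4 * √(V₀ / V₁) * (bernoulliPoly s p).coeff n := by
  have hV₀0 : 0 ≤ V₀ := by
    rw [← hV₀]
    exact Finset.sum_nonneg fun i _ => mul_nonneg (hp i).1.le (by linarith [hp i])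
  -- Any Lipschitz constant δ with δ √V₁ ≤ 4 P(N = n) suffices; two choices are made below.
  have hmain : ∀ δ : ℝ, 0 ≤ δ →
      (∀ m, |((1 - X) * bernoulliPoly (s \ s₀) p).coeff m| ≤ δ) →
      δ * √V₁ ≤ 4 * (bernoulliPoly s p).coeff n →
      ∑ k ∈ Finset.range (s₀.card + 1), (bernoulliPoly s₀ p).coeff k *
        |(X ^ k * bernoulliPoly (s \ s₀) p).coeff n - (bernoulliPoly s p).coeff n| ≤
      4 * √(V₀ / V₁) * (bernoulliPoly s p).coeff n := by
    intro δ hδ hlip hδ4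
    have e : (bernoulliPoly s p).coeff n = ∑ k ∈ Finset.range (s₀.card + 1),
        (bernoulliPoly s₀ p).coeff k * (X ^ k * bernoulliPoly (s \ s₀) p).coeff n := by
      rw [← coeff_mul_eq_sum_X_pow _ _ _ (Nat.lt_succ_of_le (natDegree_bernoulliPoly_le s₀ p)),
        bernoulliPoly_mul_sdiff s p hs]
    have h2 := sum_mul_abs_sub_le_of_lipschitz (Finset.range (s₀.card + 1))
      (bernoulliPoly s₀ p).coeff (fun k => (X ^ k * bernoulliPoly (s \ s₀) p).coeff n)
      (fun k _ => coeff_bernoulliPoly_nonneg s₀ p hp k) (sum_coeff_bernoulliPoly s₀ p) hδ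
      (abs_coeff_X_pow_mul_sub_le _ n hδ hlip) (V := V₀) (c := ∑ i ∈ s₀, p i)
      (by rw [sum_coeff_bernoulliPoly_mul_sq, hV₀]; simp)
    rw [← e] at h2
    refine h2.trans ?_
    rw [Real.sqrt_div hV₀0]
    have hs1 : 0 < √V₁ := Real.sqrt_pos.2 hpos
    have h3 := mul_le_mul_of_nonneg_right hδ4 (Real.sqrt_nonneg V₀)
    rw [mul_comm 4 (√V₀ / √V₁), div_mul_eq_mul_div, div_mul_eq_mul_div, le_div_iff₀ hs1]
    linarith
  obtain ⟨h1, h2⟩ := coeff_bernoulliPoly_mean_lower_bounds s p hp hn hmean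
    (σ := √(V₀ + V₁)) (Real.sqrt_pos.2 (by linarith))
    (by rw [Real.sq_sqrt (by linarith), ← hV₀, ← hV₁, add_comm]; exact (Finset.sum_sdiff hs).symm)
  rw [Real.sq_sqrt (by linarith)] at h1
  -- Here V₀ ≤ V₁/16 and 17/16 < 1.031².
  have hσ : √(V₀ + V₁) ≤ 1.031 * √V₁ := by
    refine Real.sqrt_le_iff.2 ⟨by positivity, ?_⟩
    rw [mul_pow, Real.sq_sqrt hpos.le]
    norm_num
    linarith
  set y := √V₁ with hy
  have hy2 : y ^ 2 = V₁ := Real.sq_sqrt hpos.le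
  have hy0 : 0 < y := Real.sqrt_pos.2 hpos
  set c := (bernoulliPoly s p).coeff n with hc
  have hc0 : 0 ≤ c := coeff_bernoulliPoly_nonneg s p hp n
  -- Chebyshev with δ = 1 works up to y ≈ 0.859, and the Fourier bound from y ≈ 0.695 on; 17/20 lies
  -- in the overlap. The value 17.72 is just below 96 · 3.14 / 17, the most that π > 3.14 permits.
  rcases le_total y (17 / 20) with hy1 | hy1
  · refine hmain 1 zero_le_one
      (fun m => abs_coeff_one_sub_X_mul_bernoulliPoly_le_one _ p hp m) ?_
    nlinarith
  · refine hmain (17 / (12 * Real.pi * V₁)) (by positivity)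
      (fun m => abs_coeff_one_sub_X_mul_bernoulliPoly_le _ p hV₁ hpos m) ?_
    have h3 : 2 ≤ c * (13.403 * y + 3) :=
      h2.trans (mul_le_mul_of_nonneg_left (by linarith) hc0)
    have h4 : 2 ≤ c * (17.72 * y) :=
      h3.trans (mul_le_mul_of_nonneg_left (by linarith) hc0)
    rw [← hy2, div_mul_eq_mul_div, div_le_iff₀ (by positivity)]
    have h5 := mul_le_mul_of_nonneg_left Real.pi_gt_d2.le (mul_nonneg hc0 hy0.le)
    have h6 : 17 ≤ 4 * c * (12 * Real.pi * y) := by nlinarith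
    nlinarith

/-- A crude version of `sum_coeff_mul_abs_sub_le` without assumptions on the variances. -/
theorem sum_coeff_mul_abs_sub_le_two (hp : ∀ i, 0 < p i ∧ p i < 1) {s₀ : Finset ι} (hs : s₀ ⊆ s)
    (n : ℕ) :
    ∑ k ∈ Finset.range (s₀.card + 1), (bernoulliPoly s₀ p).coeff k *
        |(X ^ k * bernoulliPoly (s \ s₀) p).coeff n - (bernoulliPoly s p).coeff n| ≤
      2 * (bernoulliPoly s p).coeff n := by
  have e : (bernoulliPoly s p).coeff n = ∑ k ∈ Finset.range (s₀.card + 1),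
      (bernoulliPoly s₀ p).coeff k * (X ^ k * bernoulliPoly (s \ s₀) p).coeff n := by
    rw [← coeff_mul_eq_sum_X_pow _ _ _ (Nat.lt_succ_of_le (natDegree_bernoulliPoly_le s₀ p)),
      bernoulliPoly_mul_sdiff s p hs]
  have hc0 := coeff_bernoulliPoly_nonneg s p hp n
  calc _ ≤ ∑ k ∈ Finset.range (s₀.card + 1), ((bernoulliPoly s₀ p).coeff k *
        (X ^ k * bernoulliPoly (s \ s₀) p).coeff n +
          (bernoulliPoly s₀ p).coeff k * (bernoulliPoly s p).coeff n) := by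
        refine Finset.sum_le_sum fun k _ => ?_
        rw [← mul_add]
        refine mul_le_mul_of_nonneg_left ?_ (coeff_bernoulliPoly_nonneg s₀ p hp k)
        have : 0 ≤ (X ^ k * bernoulliPoly (s \ s₀) p).coeff n := by
          rw [coeff_X_pow_mul']
          split_ifs
          · exact coeff_bernoulliPoly_nonneg _ p hp _
          · exact le_rfl
        rw [abs_le]; constructor <;> linarith
    _ = 2 * (bernoulliPoly s p).coeff n := by
        rw [Finset.sum_add_distrib, ← e, ← Finset.sum_mul, sum_coeff_bernoulliPoly]; ring

end bernoulli

/-! ### Heights in cylinders -/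

section geometry

theorem height_stickPoint (m : ℤ) : height (stickPoint m) = m := by
  simp only [height, stickPoint, Matrix.cons_val_zero, Matrix.cons_val_one, Matrix.cons_val]
  omega

theorem height_add (x y : Site) : height (x + y) = height x + height y := by
  simp only [height, Pi.add_apply]; ring

theorem stickPoint_injective : Function.Injective stickPoint := fun a b h => by
  rw [← height_stickPoint a, h, height_stickPoint]

/-- The heights of the points of the finite stick. -/
def stickHeights (L : ℕ) : Finset ℤ := Finset.Icc (-((L / 2 : ℕ) : ℤ)) ((L / 2 : ℕ) : ℤ)

theorem card_stickHeights {L : ℕ} (hL : Even L) : (stickHeights L).card = L + 1 := by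
  obtain ⟨m, rfl⟩ := hL
  rw [stickHeights, Int.card_Icc]
  omega

theorem sum_stick (L : ℕ) (φ : ℤ → ℝ) :
    ∑ x ∈ stick L, φ (height x) = ∑ m ∈ stickHeights L, φ m := by
  rw [stick, Finset.sum_image fun a _ b _ h => stickPoint_injective h]
  simp only [height_stickPoint]
  rfl

/-- The base lies at height 0 and the stick has one point per height, so a site of the cylinder
determines its stick point and hence its base point. Every height occurs |Γ| times, which makes
means and variances proportional to the base. -/
theorem sum_cylinder {Γ : Finset Site} (hΓ : ∀ x ∈ Γ, height x = 0) (L : ℕ) (φ : ℤ → ℝ) :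
    ∑ x ∈ cylinder Γ L, φ (height x) = Γ.card * ∑ m ∈ stickHeights L, φ m := by
  have hinj : Set.InjOn (fun xy : Site × Site => xy.1 + xy.2) (Γ ×ˢ stick L : Finset _) := by
    rintro ⟨x, y⟩ hxy ⟨x', y'⟩ hxy' h
    simp only [Finset.coe_product, Set.mem_prod, Finset.mem_coe] at hxy hxy' h
    obtain ⟨m, _, hm⟩ := Finset.mem_image.1 hxy.2
    obtain ⟨m', _, hm'⟩ := Finset.mem_image.1 hxy'.2
    have hh := congrArg height h
    rw [height_add, height_add, hΓ _ hxy.1, hΓ _ hxy'.1, ← hm, ← hm', height_stickPoint,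
      height_stickPoint, zero_add, zero_add] at hh
    have hy : y = y' := by rw [← hm, ← hm', hh]
    subst hy
    exact Prod.ext (add_right_cancel h) rfl
  have hcyl : cylinder Γ L = (Γ ×ˢ stick L).image fun xy => xy.1 + xy.2 := rfl
  rw [hcyl, Finset.sum_image hinj, Finset.sum_product,
    ← sum_stick, ← nsmul_eq_mul, ← Finset.sum_const]
  refine Finset.sum_congr rfl fun x hx => Finset.sum_congr rfl fun y _ => ?_
  simp only [height_add, hΓ x hx, zero_add]

theorem card_cylinder {Γ : Finset Site} (hΓ : ∀ x ∈ Γ, height x = 0) {L : ℕ} (hL : Even L) :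
    (cylinder Γ L).card = Γ.card * (L + 1) := by
  have h := sum_cylinder hΓ L fun _ => 1
  simp only [Finset.sum_const, nsmul_eq_mul, mul_one, card_stickHeights hL] at h
  exact_mod_cast h

end geometry

/-! ### Occupation probabilities and the chemical potential -/

section occupation

/-- The grand canonical occupation probability of a site at height `m`. -/
def occupation (q μ : ℝ) (m : ℤ) : ℝ :=
  (q ^ ((m : ℝ) - μ)) ^ 2 / (1 + (q ^ ((m : ℝ) - μ)) ^ 2)

variable {q : ℝ}

theorem occupation_pos (hq0 : 0 < q) (μ : ℝ) (m : ℤ) :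
    0 < occupation q μ m ∧ occupation q μ m < 1 := by
  have h : 0 < (q ^ ((m : ℝ) - μ)) ^ 2 := pow_pos (Real.rpow_pos_of_pos hq0 _) 2
  refine ⟨by unfold occupation; positivity, ?_⟩
  rw [occupation, div_lt_one (by positivity)]
  linarith

theorem one_sub_occupation (hq0 : 0 < q) (μ : ℝ) (m : ℤ) :
    1 - occupation q μ m = 1 / (1 + (q ^ ((m : ℝ) - μ)) ^ 2) := by
  have h : 0 < (q ^ ((m : ℝ) - μ)) ^ 2 := pow_pos (Real.rpow_pos_of_pos hq0 _) 2
  rw [occupation]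
  field_simp
  ring

theorem occupation_strictMono (hq0 : 0 < q) (hq1 : q < 1) (m : ℤ) :
    StrictMono fun μ => occupation q μ m := by
  intro μ ν h
  have h1 : q ^ ((m : ℝ) - μ) < q ^ ((m : ℝ) - ν) :=
    Real.rpow_lt_rpow_of_exponent_gt hq0 hq1 (by linarith)
  have h0 : 0 < q ^ ((m : ℝ) - μ) := Real.rpow_pos_of_pos hq0 _
  have h2 : (q ^ ((m : ℝ) - μ)) ^ 2 < (q ^ ((m : ℝ) - ν)) ^ 2 := by gcongr
  have h3 : 1 - occupation q ν m < 1 - occupation q μ m := by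
    rw [one_sub_occupation hq0, one_sub_occupation hq0]
    gcongr
  exact sub_lt_sub_iff_left 1 |>.1 h3

theorem occupation_continuous (hq0 : 0 < q) (m : ℤ) :
    Continuous fun μ => occupation q μ m := by
  have h : Continuous fun μ : ℝ => q ^ ((m : ℝ) - μ) :=
    (Real.continuous_const_rpow hq0.ne').comp (by fun_prop)
  exact (h.pow 2).div (continuous_const.add (h.pow 2)) fun μ =>
    (add_pos_of_pos_of_nonneg one_pos (sq_nonneg _)).ne'

theorem occupation_zero_add_neg (hq0 : 0 < q) (m : ℤ) :
    occupation q 0 m + occupation q 0 (-m) = 1 := by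
  have h : 0 < (q ^ (m : ℝ)) ^ 2 := pow_pos (Real.rpow_pos_of_pos hq0 _) 2
  rw [occupation, occupation]
  push_cast
  rw [sub_zero, sub_zero, Real.rpow_neg hq0.le]
  field_simp
  ring

open Filter Topology in
theorem occupation_tendsto_atBot (hq0 : 0 < q) (hq1 : q < 1) (m : ℤ) :
    Tendsto (fun μ => occupation q μ m) atBot (𝓝 0) := by
  have h1 : Tendsto (fun μ : ℝ => (m : ℝ) - μ) atBot atTop :=
    tendsto_atTop_add_const_left _ _ tendsto_neg_atBot_atTop
  have h2 : Tendsto (fun μ : ℝ => q ^ ((m : ℝ) - μ)) atBot (𝓝 0) :=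
    (tendsto_rpow_atTop_of_base_lt_one q (by linarith) hq1).comp h1
  have h3 : Tendsto (fun μ => occupation q μ m) atBot (𝓝 (0 ^ 2 / (1 + 0 ^ 2))) :=
    (h2.pow 2).div ((h2.pow 2).const_add 1) (by norm_num)
  simpa using h3

open Filter Topology in
theorem occupation_tendsto_atTop (hq0 : 0 < q) (hq1 : q < 1) (m : ℤ) :
    Tendsto (fun μ => occupation q μ m) atTop (𝓝 1) := by
  have h1 : Tendsto (fun μ : ℝ => (m : ℝ) - μ) atTop atBot :=
    tendsto_atBot_add_const_left _ _ tendsto_neg_atTop_atBot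
  have h2 : Tendsto (fun μ : ℝ => q ^ ((m : ℝ) - μ)) atTop atTop :=
    (tendsto_rpow_atBot_of_base_lt_one q hq0 hq1).comp h1
  have h3 : Tendsto (fun μ : ℝ => 1 + (q ^ ((m : ℝ) - μ)) ^ 2) atTop atTop :=
    tendsto_atTop_add_const_left _ _ ((tendsto_pow_atTop two_ne_zero).comp h2)
  have h4 := (tendsto_inv_atTop_zero.comp h3).const_sub 1
  rw [sub_zero] at h4
  refine h4.congr fun μ => ?_
  have := one_sub_occupation hq0 μ m
  simp only [Function.comp]
  rw [← one_div]
  linarith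

/-- The grand canonical expectation of the number of particles on the stick. -/
def stickDensity (q : ℝ) (L : ℕ) (μ : ℝ) : ℝ := ∑ m ∈ stickHeights L, occupation q μ m

theorem zero_mem_stickHeights (L : ℕ) : (0 : ℤ) ∈ stickHeights L := by
  rw [stickHeights, Finset.mem_Icc]; omega

theorem stickDensity_strictMono (hq0 : 0 < q) (hq1 : q < 1) (L : ℕ) :
    StrictMono (stickDensity q L) := fun _ _ h =>
  Finset.sum_lt_sum_of_nonempty ⟨0, zero_mem_stickHeights L⟩ fun m _ =>
    occupation_strictMono hq0 hq1 m h

theorem exists_stickDensity_eq (hq0 : 0 < q) (hq1 : q < 1) {L : ℕ} (hL : Even L) {c : ℝ}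
    (hc0 : 0 < c) (hc1 : c < L + 1) : ∃ μ, stickDensity q L μ = c := by
  have hcont : Continuous (stickDensity q L) :=
    continuous_finsetSum _ fun m _ => occupation_continuous hq0 m
  have hbot := tendsto_finsetSum (stickHeights L)
    fun m _ => occupation_tendsto_atBot hq0 hq1 m
  have htop := tendsto_finsetSum (stickHeights L)
    fun m _ => occupation_tendsto_atTop hq0 hq1 m
  simp only [Finset.sum_const_zero, Finset.sum_const, card_stickHeights hL, nsmul_eq_mul,
    mul_one] at hbot htop
  push_cast at htop
  obtain ⟨a, ha⟩ := (hbot.eventually (gt_mem_nhds hc0)).exists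
  obtain ⟨b, hb⟩ := (htop.eventually (lt_mem_nhds hc1)).exists
  exact mem_range_of_exists_le_of_exists_ge hcont ⟨a, ha.le⟩ ⟨b, hb.le⟩

theorem stickDensity_zero (hq0 : 0 < q) {L : ℕ} (hL : Even L) :
    stickDensity q L 0 = (L + 1) / 2 := by
  have h1 : stickDensity q L 0 = ∑ m ∈ stickHeights L, occupation q 0 (-m) := by
    refine Finset.sum_nbij' (fun m => -m) (fun m => -m) ?_ ?_ ?_ ?_ ?_ <;>
      intro m hm <;> simp only [stickHeights, Finset.mem_Icc, neg_neg] at * <;> omega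
  have h2 : stickDensity q L 0 + ∑ m ∈ stickHeights L, occupation q 0 (-m) = L + 1 := by
    rw [stickDensity, ← Finset.sum_add_distrib]
    simp only [occupation_zero_add_neg hq0, Finset.sum_const, card_stickHeights hL, nsmul_eq_mul,
      mul_one]
    push_cast; rfl
  linarith

end occupation

/-! ### Splitting configurations -/

section configurations

variable {Λ₀ Λ : Finset Site}

/-- The configuration on `Λ` with given restrictions to `Λ₀` and to its complement. -/
def join (γ : Conf Λ₀) (δ : Conf (Λ \ Λ₀)) : Conf Λ := fun x =>
  if h : x.1 ∈ Λ₀ then γ ⟨x.1, h⟩ else δ ⟨x.1, Finset.mem_sdiff.2 ⟨x.2, h⟩⟩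

theorem restrict_join (h : Λ₀ ⊆ Λ) (γ : Conf Λ₀) (δ : Conf (Λ \ Λ₀)) :
    restrict h (join γ δ) = γ := by
  ext x; simp [restrict, join]

theorem override_join (γ γ' : Conf Λ₀) (δ : Conf (Λ \ Λ₀)) :
    override (join γ δ) γ' = join γ' δ := by
  ext x; simp only [override, join]; split_ifs <;> rfl

/-- Configurations on `Λ` are pairs of configurations on `Λ₀` and on its complement. -/
def joinEquiv (h : Λ₀ ⊆ Λ) : Conf Λ₀ × Conf (Λ \ Λ₀) ≃ Conf Λ where
  toFun γδ := join γδ.1 γδ.2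
  invFun β := (restrict h β, restrict Finset.sdiff_subset β)
  left_inv := by
    rintro ⟨γ, δ⟩
    refine Prod.ext (restrict_join h γ δ) ?_
    ext x
    simp [restrict, join, (Finset.mem_sdiff.1 x.2).2]
  right_inv β := by
    ext x; simp only [restrict, join]; split_ifs <;> rfl

/-- The general monoid serves both the amplitudes and, through `Multiplicative ℕ`, the particle
count. -/
theorem prod_join {M : Type*} [CommMonoid M] (h : Λ₀ ⊆ Λ) (f : Site → Fin 2 → M)
    (γ : Conf Λ₀) (δ : Conf (Λ \ Λ₀)) :
    ∏ x : ↥Λ, f x.1 (join γ δ x) = (∏ x : ↥Λ₀, f x.1 (γ x)) * ∏ x : ↥(Λ \ Λ₀), f x.1 (δ x) := by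
  let g : Site → M := fun x => if hx : x ∈ Λ then f x (join γ δ ⟨x, hx⟩) else 1
  have e1 : ∏ x : ↥Λ, f x.1 (join γ δ x) = ∏ x ∈ Λ, g x :=
    (Finset.prod_congr rfl fun x _ => by simp [g]).trans (Finset.prod_coe_sort Λ g)
  have e2 : ∏ x : ↥Λ₀, f x.1 (γ x) = ∏ x ∈ Λ₀, g x :=
    (Finset.prod_congr rfl fun x _ => by simp [g, h x.2, join]).trans (Finset.prod_coe_sort Λ₀ g)
  have e3 : ∏ x : ↥(Λ \ Λ₀), f x.1 (δ x) = ∏ x ∈ Λ \ Λ₀, g x := by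
    refine Eq.trans (Finset.prod_congr rfl fun x _ => ?_) (Finset.prod_coe_sort (Λ \ Λ₀) g)
    have hx := Finset.mem_sdiff.1 x.2
    simp [g, hx.1, hx.2, join]
  rw [e1, e2, e3, mul_comm, Finset.prod_sdiff h]

theorem count_join (h : Λ₀ ⊆ Λ) (γ : Conf Λ₀) (δ : Conf (Λ \ Λ₀)) :
    count (join γ δ) = count γ + count δ :=
  prod_join (M := Multiplicative ℕ) h (fun _ s => Multiplicative.ofAdd (s : ℕ)) γ δ

theorem count_le_card (α : Conf Λ) : count α ≤ Λ.card := by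
  have : count α ≤ ∑ _x : ↥Λ, 1 := Finset.sum_le_sum fun x _ => by omega
  simpa using this

end configurations

/-! ### Amplitudes and the law of the particle number -/

section weights

variable (q : ℝ) {Λ₀ Λ : Finset Site}

/-- The amplitude `∏ₓ q^{l(x) α(x)}` of a configuration. -/
def weight (α : Conf Λ) : ℝ := ∏ x, q ^ (height x.1 * ((α x : ℕ) : ℤ))

/-- The amplitude of a configuration in the grand canonical vector. -/
def weightGC (μ : ℝ) (α : Conf Λ) : ℝ :=
  ∏ x, (if α x = 0 then 1 else q ^ ((height x.1 : ℝ) - μ))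

theorem psi_apply (n : ℕ) (α : Conf Λ) :
    psi q Λ n α = if count α = n then (weight q α : ℂ) else 0 := rfl

theorem psiGC_apply (μ : ℝ) (α : Conf Λ) : psiGC q Λ μ α = (weightGC q μ α : ℂ) := rfl

theorem weight_join (h : Λ₀ ⊆ Λ) (γ : Conf Λ₀) (δ : Conf (Λ \ Λ₀)) :
    weight q (join γ δ) = weight q γ * weight q δ :=
  prod_join h (fun x s => q ^ (height x * ((s : ℕ) : ℤ))) γ δ

variable {q}

/-- At fixed particle number, μ enters only as a scalar: conditioning the grand canonical state on
the number yields the canonical one. -/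
theorem weightGC_eq (hq0 : 0 < q) (μ : ℝ) (α : Conf Λ) :
    weightGC q μ α = weight q α * (q ^ (-μ)) ^ count α := by
  rw [weightGC, weight, count, ← Finset.prod_pow_eq_pow_sum, ← Finset.prod_mul_distrib]
  refine Finset.prod_congr rfl fun x _ => ?_
  generalize α x = s
  fin_cases s
  · simp
  · simp [sub_eq_add_neg, Real.rpow_add hq0]

/-- The normalization of the grand canonical vector. -/
def partitionGC (q : ℝ) (Λ : Finset Site) (μ : ℝ) : ℝ :=
  ∏ x ∈ Λ, (1 + (q ^ ((height x : ℝ) - μ)) ^ 2)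

theorem partitionGC_pos (μ : ℝ) : 0 < partitionGC q Λ μ :=
  Finset.prod_pos fun x _ => by positivity

theorem partitionGC_mul_sdiff (h : Λ₀ ⊆ Λ) (μ : ℝ) :
    partitionGC q Λ₀ μ * partitionGC q (Λ \ Λ₀) μ = partitionGC q Λ μ := by
  rw [mul_comm]; exact Finset.prod_sdiff h

/-- The generating polynomial of the particle number in the grand canonical state. -/
def numberPoly (q : ℝ) (Λ : Finset Site) (μ : ℝ) : ℝ[X] :=
  bernoulliPoly Λ fun x => occupation q μ (height x)

/-- Expanding the product over sites amounts to choosing one of two summands at each site, that is,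
a configuration; its power of X is the particle count. -/
theorem coeff_numberPoly (hq0 : 0 < q) (μ : ℝ) (k : ℕ) :
    (numberPoly q Λ μ).coeff k =
      (∑ α : Conf Λ, if count α = k then weightGC q μ α ^ 2 else 0) / partitionGC q Λ μ := by
  let f : ↥Λ → Fin 2 → ℝ := fun x s =>
    (if s = 0 then 1 else q ^ ((height x.1 : ℝ) - μ)) ^ 2 /
      (1 + (q ^ ((height x.1 : ℝ) - μ)) ^ 2)
  have e1 : numberPoly q Λ μ = ∏ x : ↥Λ, ∑ s : Fin 2, C (f x s) * X ^ (s : ℕ) := by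
    rw [numberPoly, bernoulliPoly, ← Finset.prod_coe_sort]
    refine Finset.prod_congr rfl fun x _ => ?_
    rw [Fin.sum_univ_two, one_sub_occupation hq0]
    simp [f, occupation]
  have e2 : ∀ α : Conf Λ, ∏ x, f x (α x) = weightGC q μ α ^ 2 / partitionGC q Λ μ := by
    intro α
    rw [weightGC, partitionGC, ← Finset.prod_coe_sort Λ, ← Finset.prod_pow,
      ← Finset.prod_div_distrib]
  rw [e1, Fintype.prod_sum, finsetSum_coeff, Finset.sum_div]
  refine Finset.sum_congr rfl fun α _ => ?_
  rw [Finset.prod_mul_distrib, ← map_prod, Finset.prod_pow_eq_pow_sum, coeff_C_mul_X_pow, e2]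
  have : (k = ∑ x, (α x : ℕ)) ↔ count α = k := eq_comm
  simp only [this]
  split_ifs <;> simp

theorem sum_weightGC_sq (hq0 : 0 < q) (μ : ℝ) (φ : ℕ → ℝ) :
    ∑ α : Conf Λ, weightGC q μ α ^ 2 * φ (count α) =
      partitionGC q Λ μ *
        ∑ k ∈ Finset.range (Λ.card + 1), (numberPoly q Λ μ).coeff k * φ k := by
  have hD := (partitionGC_pos (q := q) (Λ := Λ) μ).ne'
  have e : ∀ k, partitionGC q Λ μ * ((numberPoly q Λ μ).coeff k * φ k) =
      ∑ α : Conf Λ, if count α = k then weightGC q μ α ^ 2 * φ k else 0 := by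
    intro k
    rw [coeff_numberPoly hq0, ← mul_assoc, mul_div_cancel₀ _ hD, Finset.sum_mul]
    exact Finset.sum_congr rfl fun α _ => by split_ifs <;> simp
  simp only [Finset.mul_sum, e]
  rw [Finset.sum_comm]
  refine Finset.sum_congr rfl fun α _ => ?_
  rw [Finset.sum_ite_eq, if_pos (Finset.mem_range.2 (Nat.lt_succ_of_le (count_le_card α)))]

theorem sum_weightGC_sq_eq_partitionGC (hq0 : 0 < q) (μ : ℝ) :
    ∑ α : Conf Λ, weightGC q μ α ^ 2 = partitionGC q Λ μ := by
  have h := sum_weightGC_sq (Λ := Λ) hq0 μ fun _ => 1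
  simp only [mul_one] at h
  rw [h, numberPoly, sum_coeff_bernoulliPoly, mul_one]

end weights

/-! ### Canonical and grand canonical expectations as mixtures -/

section expectations

variable {q : ℝ} {Λ₀ Λ : Finset Site}

theorem inner_eq_sum (ψ φ : Hilb Λ) :
    inner ℂ ψ φ = ∑ α, φ α * (starRingEnd ℂ) (ψ α) := by
  rw [PiLp.inner_apply]; rfl

theorem inner_psiGC_self (hq0 : 0 < q) (μ : ℝ) :
    inner ℂ (psiGC q Λ μ) (psiGC q Λ μ) = (partitionGC q Λ μ : ℂ) := by
  rw [inner_eq_sum, ← sum_weightGC_sq_eq_partitionGC hq0]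
  push_cast
  refine Finset.sum_congr rfl fun α _ => ?_
  rw [psiGC_apply, Complex.conj_ofReal, sq]

theorem inner_psi_self (hq0 : 0 < q) (μ : ℝ) (k : ℕ) :
    ((q ^ (-μ)) ^ (2 * k) : ℝ) * inner ℂ (psi q Λ k) (psi q Λ k) =
      ((partitionGC q Λ μ * (numberPoly q Λ μ).coeff k : ℝ) : ℂ) := by
  rw [coeff_numberPoly hq0, mul_div_cancel₀ _ (partitionGC_pos μ).ne', inner_eq_sum,
    Finset.mul_sum]
  push_cast
  refine Finset.sum_congr rfl fun α _ => ?_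
  rw [psi_apply]
  split_ifs with h
  · rw [weightGC_eq hq0, h, Complex.conj_ofReal]; push_cast; ring
  · simp

/-- The zero vector is included, with 0/0 = 0, because canonical vectors vanish beyond the number of
sites. -/
theorem expect_mul_inner_self (ψ : Hilb Λ) (A : Hilb Λ →L[ℂ] Hilb Λ) :
    expect ψ A * inner ℂ ψ ψ = inner ℂ ψ (A ψ) := by
  rcases eq_or_ne ψ 0 with rfl | h
  · simp
  · rw [expect, div_mul_cancel₀ _ (inner_self_ne_zero.2 h)]

theorem inner_psi_apply (hq0 : 0 < q) (μ : ℝ) (k : ℕ) (A : Hilb Λ →L[ℂ] Hilb Λ) :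
    ((q ^ (-μ)) ^ (2 * k) : ℝ) * inner ℂ (psi q Λ k) (A (psi q Λ k)) =
      (partitionGC q Λ μ * (numberPoly q Λ μ).coeff k : ℝ) * canExp q Λ k A := by
  rw [← inner_psi_self hq0, ← expect_mul_inner_self, canExp]; ring

theorem diagOp_apply (f : Conf Λ → ℂ) (ψ : Hilb Λ) (α : Conf Λ) :
    diagOp f ψ α = f α * ψ α := by
  rw [diagOp, Matrix.ofLp_toEuclideanCLM, Matrix.mulVec_diagonal]

theorem totalSpinZ_apply (ψ : Hilb Λ) (α : Conf Λ) :
    totalSpinZ Λ ψ α = ((Λ.card : ℂ) / 2 - count α) * ψ α := by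
  have e : totalSpinZ Λ ψ α = ∑ x : ↥Λ, (if α x = 0 then (1 / 2 : ℂ) else -(1 / 2)) * ψ α := by
    rw [totalSpinZ, sum_apply, WithLp.ofLp_sum, Finset.sum_apply]
    exact Finset.sum_congr rfl fun x _ => diagOp_apply _ _ _
  rw [e, ← Finset.sum_mul]
  congr 1
  have : ∀ x : ↥Λ, (if α x = 0 then (1 / 2 : ℂ) else -(1 / 2)) = 1 / 2 - ((α x : ℕ) : ℂ) := by
    intro x
    generalize α x = s
    fin_cases s <;> norm_num
  simp only [this, Finset.sum_sub_distrib, count]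
  push_cast
  simp [div_eq_mul_inv]

theorem ampliation_apply_join (h : Λ₀ ⊆ Λ) (A : Hilb Λ₀ →L[ℂ] Hilb Λ₀) (ψ : Hilb Λ)
    (γ : Conf Λ₀) (δ : Conf (Λ \ Λ₀)) :
    ampliation h A ψ (join γ δ) = A (slice (join γ δ) ψ) γ := by
  change A (slice (join γ δ) ψ) (restrict h (join γ δ)) = _
  rw [restrict_join]

/-- A local observable that commutes with the total spin preserves the particle number. -/
theorem apply_psi_eq_zero (h : Λ₀ ⊆ Λ) {A : Hilb Λ₀ →L[ℂ] Hilb Λ₀}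
    (hA : Commute (ampliation h A) (totalSpinZ Λ)) {k : ℕ} {γ : Conf Λ₀} (hγ : count γ ≠ k) :
    A (psi q Λ₀ k) γ = 0 := by
  classical
  -- Tensoring with all spins up outside Λ₀ gives an eigenvector of the total spin of Λ, so
  -- commutation on Λ forces number conservation on Λ₀.
  let Φ : Hilb Λ := WithLp.toLp 2 fun β =>
    if restrict Finset.sdiff_subset β = (0 : Conf (Λ \ Λ₀)) then psi q Λ₀ k (restrict h β) else 0
  have hΦ : ∀ γ δ, Φ (join γ δ) = if δ = 0 then psi q Λ₀ k γ else 0 := by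
    intro γ δ
    have e := (joinEquiv h).left_inv (γ, δ)
    have e1 := congrArg Prod.fst e
    have e2 := congrArg Prod.snd e
    simp only [joinEquiv] at e1 e2
    change (if restrict Finset.sdiff_subset (join γ δ) = (0 : Conf (Λ \ Λ₀)) then
      psi q Λ₀ k (restrict h (join γ δ)) else 0) = _
    rw [e1, e2]
  have hslice : slice (join γ (0 : Conf (Λ \ Λ₀))) Φ = psi q Λ₀ k := by
    ext γ'
    change Φ (override (join γ 0) γ') = _
    rw [override_join, hΦ, if_pos rfl]
  have hc0 : count (0 : Conf (Λ \ Λ₀)) = 0 := by simp [count]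
  have hJ : totalSpinZ Λ Φ = ((Λ.card : ℂ) / 2 - k) • Φ := by
    ext β
    obtain ⟨⟨γ', δ⟩, rfl⟩ := (joinEquiv h).surjective β
    change totalSpinZ Λ Φ (join γ' δ) = ((Λ.card : ℂ) / 2 - k) * Φ (join γ' δ)
    rw [totalSpinZ_apply, hΦ, count_join h]
    split_ifs with hδ
    · rw [psi_apply]
      split_ifs with hk
      · rw [hδ, hc0, hk, add_zero]
      · simp
    · simp
  have key : ampliation h A (totalSpinZ Λ Φ) (join γ (0 : Conf (Λ \ Λ₀))) =
      totalSpinZ Λ (ampliation h A Φ) (join γ (0 : Conf (Λ \ Λ₀))) :=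
    congrArg (fun T : Hilb Λ →L[ℂ] Hilb Λ => T Φ (join γ (0 : Conf (Λ \ Λ₀)))) hA.eq
  rw [hJ, map_smul, totalSpinZ_apply, PiLp.smul_apply, smul_eq_mul, ampliation_apply_join, hslice,
    count_join h, hc0, add_zero] at key
  have hne : (k : ℂ) - count γ ≠ 0 := sub_ne_zero.2 (by exact_mod_cast hγ.symm)
  have : ((k : ℂ) - count γ) * A (psi q Λ₀ k) γ = 0 := by linear_combination -key
  exact (mul_eq_zero.1 this).resolve_left hne

theorem psiGC_eq_sum (hq0 : 0 < q) (μ : ℝ) :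
    psiGC q Λ μ = ∑ k ∈ Finset.range (Λ.card + 1), (((q ^ (-μ)) ^ k : ℝ) : ℂ) • psi q Λ k := by
  ext α
  rw [WithLp.ofLp_sum, Finset.sum_apply, psiGC_apply, weightGC_eq hq0]
  simp only [PiLp.smul_apply, psi_apply, smul_eq_mul, mul_ite, mul_zero]
  rw [Finset.sum_ite_eq, if_pos (Finset.mem_range.2 (Nat.lt_succ_of_le (count_le_card α)))]
  push_cast; ring

/-- The grand canonical expectation is a mixture of canonical ones. -/
theorem gcExp_eq_sum (hq0 : 0 < q) (h : Λ₀ ⊆ Λ) {A : Hilb Λ₀ →L[ℂ] Hilb Λ₀}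
    (hA : Commute (ampliation h A) (totalSpinZ Λ)) (μ : ℝ) :
    gcExp q Λ₀ μ A = ∑ k ∈ Finset.range (Λ₀.card + 1),
      ((numberPoly q Λ₀ μ).coeff k : ℂ) * canExp q Λ₀ k A := by
  -- Number conservation kills the cross terms between sectors.
  have horth : ∀ j k, j ≠ k → inner ℂ (psi q Λ₀ j) (A (psi q Λ₀ k)) = 0 := by
    intro j k hjk
    rw [inner_eq_sum]
    refine Finset.sum_eq_zero fun γ _ => ?_
    rw [psi_apply]
    split_ifs with hγ
    · rw [apply_psi_eq_zero h hA (hγ.trans_ne hjk), zero_mul]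
    · simp
  have hD : (partitionGC q Λ₀ μ : ℂ) ≠ 0 := by exact_mod_cast (partitionGC_pos μ).ne'
  rw [gcExp, expect, inner_psiGC_self hq0, div_eq_iff hD, psiGC_eq_sum hq0, map_sum, sum_inner,
    Finset.sum_mul]
  refine Finset.sum_congr rfl fun k hk => ?_
  rw [inner_sum, Finset.sum_eq_single k]
  · rw [map_smul, inner_smul_left, inner_smul_right, Complex.conj_ofReal]
    have := inner_psi_apply (Λ := Λ₀) hq0 μ k A
    push_cast at this ⊢
    linear_combination this
  · intro j _ hj
    rw [map_smul, inner_smul_left, inner_smul_right, horth k j hj.symm]; simp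
  · intro hk'; exact absurd hk hk'

/-- The canonical expectation of a local observable is a mixture of local canonical ones. -/
theorem canExp_ampliation_mul (hq0 : 0 < q) (h : Λ₀ ⊆ Λ) (A : Hilb Λ₀ →L[ℂ] Hilb Λ₀) (μ : ℝ)
    (n : ℕ) :
    ((numberPoly q Λ μ).coeff n : ℂ) * canExp q Λ n (ampliation h A) =
      ∑ k ∈ Finset.range (Λ₀.card + 1),
        ((numberPoly q Λ₀ μ).coeff k * (X ^ k * numberPoly q (Λ \ Λ₀) μ).coeff n : ℝ) *
          canExp q Λ₀ k A := by
  have hD : (partitionGC q Λ μ : ℂ) ≠ 0 := by exact_mod_cast (partitionGC_pos μ).ne'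
  have hD' : (partitionGC q Λ μ : ℂ) =
      (partitionGC q Λ₀ μ : ℂ) * (partitionGC q (Λ \ Λ₀) μ : ℂ) := by
    exact_mod_cast (partitionGC_mul_sdiff h μ).symm
  have hD1 : partitionGC q (Λ \ Λ₀) μ ≠ 0 := (partitionGC_pos μ).ne'
  refine mul_left_cancel₀ hD ?_
  have e1 := inner_psi_apply (Λ := Λ) hq0 μ n (ampliation h A)
  rw [Complex.ofReal_mul] at e1
  rw [← mul_assoc, ← e1, inner_eq_sum, ← (joinEquiv h).sum_comp, Fintype.sum_prod_type_right]
  -- With the exterior configuration δ frozen, the canonical vector on Λ becomes a multiple of the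
  -- canonical vector on Λ₀ with the remaining n - |δ| particles.
  have hslice : ∀ (γ : Conf Λ₀) (δ : Conf (Λ \ Λ₀)), slice (join γ δ) (psi q Λ n) =
      if count δ ≤ n then (weight q δ : ℂ) • psi q Λ₀ (n - count δ) else 0 := by
    intro γ δ
    ext γ'
    change psi q Λ n (override (join γ δ) γ') = _
    rw [override_join, psi_apply, count_join h, weight_join q h]
    by_cases hδ : count δ ≤ n
    · rw [if_pos hδ, PiLp.smul_apply, psi_apply, smul_eq_mul, mul_ite, mul_zero]
      have : count γ' + count δ = n ↔ count γ' = n - count δ := by omega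
      simp only [this]
      split_ifs
      · push_cast; ring
      · rfl
    · rw [if_neg hδ, if_neg (by omega)]; rfl
  have hδ : ∀ δ : Conf (Λ \ Λ₀),
      (((q ^ (-μ)) ^ (2 * n) : ℝ) : ℂ) * ∑ γ : Conf Λ₀,
        ampliation h A (psi q Λ n) (joinEquiv h (γ, δ)) *
          (starRingEnd ℂ) (psi q Λ n (joinEquiv h (γ, δ))) =
      ∑ k ∈ Finset.range (Λ₀.card + 1), if count δ + k = n then
        ((weightGC q μ δ ^ 2 : ℝ) : ℂ) *
          ((partitionGC q Λ₀ μ * (numberPoly q Λ₀ μ).coeff k : ℝ) * canExp q Λ₀ k A) else 0 := by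
    intro δ
    have e2 : ∀ γ : Conf Λ₀, ampliation h A (psi q Λ n) (joinEquiv h (γ, δ)) *
          (starRingEnd ℂ) (psi q Λ n (joinEquiv h (γ, δ))) =
        A (if count δ ≤ n then (weight q δ : ℂ) • psi q Λ₀ (n - count δ) else 0) γ *
          (starRingEnd ℂ)
            ((if count δ ≤ n then (weight q δ : ℂ) • psi q Λ₀ (n - count δ) else 0 : Hilb Λ₀) γ) := by
      intro γ
      change ampliation h A (psi q Λ n) (join γ δ) *
          (starRingEnd ℂ) (psi q Λ n (join γ δ)) = _
      rw [ampliation_apply_join, ← hslice γ δ]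
      congr 2
      change _ = psi q Λ n (override (join γ δ) γ)
      rw [override_join]
    rw [Finset.sum_congr rfl fun γ _ => e2 γ, ← inner_eq_sum]
    by_cases hn : count δ ≤ n
    · obtain ⟨k, rfl⟩ := Nat.exists_eq_add_of_le hn
      simp only [if_pos hn, Nat.add_sub_cancel_left, add_right_inj]
      rw [Finset.sum_ite_eq', map_smul, inner_smul_left, inner_smul_right, Complex.conj_ofReal]
      have e3 := inner_psi_apply (Λ := Λ₀) hq0 μ k A
      have e4 : (((q ^ (-μ)) ^ (2 * (count δ + k)) : ℝ) : ℂ) * ((weight q δ : ℂ) *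
          ((weight q δ : ℂ) * inner ℂ (psi q Λ₀ k) (A (psi q Λ₀ k)))) =
          ((weightGC q μ δ ^ 2 : ℝ) : ℂ) *
          ((partitionGC q Λ₀ μ * (numberPoly q Λ₀ μ).coeff k : ℝ) * canExp q Λ₀ k A) := by
        rw [← e3, weightGC_eq hq0]; push_cast; ring
      rw [e4]
      split_ifs with hk
      · rfl
      · have : (numberPoly q Λ₀ μ).coeff k = 0 := by
          refine coeff_eq_zero_of_natDegree_lt ((natDegree_bernoulliPoly_le _ _).trans_lt ?_)
          simp only [Finset.mem_range] at hk
          omega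
        rw [this]; simp
    · simp only [if_neg hn]
      rw [map_zero, inner_zero_left, mul_zero]
      refine (Finset.sum_eq_zero fun k _ => if_neg (by omega)).symm
  rw [Finset.mul_sum, Finset.sum_congr rfl fun δ _ => hδ δ, Finset.sum_comm, Finset.mul_sum]
  refine Finset.sum_congr rfl fun k _ => ?_
  have e5 : (X ^ k * numberPoly q (Λ \ Λ₀) μ).coeff n * partitionGC q (Λ \ Λ₀) μ =
      ∑ δ : Conf (Λ \ Λ₀), if count δ + k = n then weightGC q μ δ ^ 2 else 0 := by
    rw [coeff_X_pow_mul']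
    split_ifs with hk
    · rw [coeff_numberPoly hq0, div_mul_cancel₀ _ hD1]
      refine Finset.sum_congr rfl fun δ _ => ?_
      have : count δ = n - k ↔ count δ + k = n := by omega
      simp only [this]
    · rw [zero_mul]
      exact (Finset.sum_eq_zero fun δ _ => if_neg (by omega)).symm
  have e6 := congrArg (fun r : ℝ => (r : ℂ)) e5
  push_cast at e6
  have e7 : ∀ (δ : Conf (Λ \ Λ₀)) (z : ℂ), (if count δ + k = n then
      ((weightGC q μ δ ^ 2 : ℝ) : ℂ) * z else 0) =
      (if count δ + k = n then (weightGC q μ δ : ℂ) ^ 2 else 0) * z := by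
    intro δ z; split_ifs <;> simp
  simp only [e7]
  have e8 : ∀ δ : Conf (Λ \ Λ₀), ((if count δ + k = n then weightGC q μ δ ^ 2 else 0 : ℝ) : ℂ) =
      if count δ + k = n then (weightGC q μ δ : ℂ) ^ 2 else 0 := by
    intro δ; split_ifs <;> simp
  rw [← Finset.sum_mul]
  simp only [e8] at e6
  rw [← e6, hD']
  push_cast
  ring

/-- The grand canonical particle number. -/
theorem gcExp_numberOp (hq0 : 0 < q) (μ : ℝ) :
    gcExp q Λ μ (numberOp Λ) = ((∑ x ∈ Λ, occupation q μ (height x) : ℝ) : ℂ) := by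
  have hD : (partitionGC q Λ μ : ℂ) ≠ 0 := by exact_mod_cast (partitionGC_pos μ).ne'
  rw [gcExp, expect, inner_psiGC_self hq0, div_eq_iff hD, ← sum_coeff_bernoulliPoly_mul_id,
    ← Complex.ofReal_mul, mul_comm]
  have h := sum_weightGC_sq (Λ := Λ) hq0 μ fun k => (k : ℝ)
  rw [numberPoly] at h
  rw [← h, inner_eq_sum]
  push_cast
  refine Finset.sum_congr rfl fun α _ => ?_
  rw [numberOp, diagOp_apply, psiGC_apply, Complex.conj_ofReal]
  ring

end expectations

/-! ### Canonical vectors as ground states -/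

section groundStates

variable {q : ℝ} {Λ : Finset Site}

theorem prod_update_update {M : Type*} [CommMonoid M] (f : ↥Λ → Fin 2 → M) (α : Conf Λ)
    {x y : ↥Λ} (hxy : x ≠ y) (s t : Fin 2) :
    ∏ z, f z (Function.update (Function.update α x s) y t z) =
      f y t * (f x s * ∏ z ∈ (Finset.univ.erase y).erase x, f z (α z)) := by
  rw [← Finset.mul_prod_erase _ _ (Finset.mem_univ y),
    ← Finset.mul_prod_erase _ _ (Finset.mem_erase.2 ⟨hxy, Finset.mem_univ x⟩),
    Function.update_self, Function.update_of_ne hxy, Function.update_self]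
  congr 2
  refine Finset.prod_congr rfl fun z hz => ?_
  simp only [Finset.mem_erase] at hz
  rw [Function.update_of_ne hz.2.1, Function.update_of_ne hz.1]

/-- Raising a particle by one level multiplies its amplitude by q; this is orthogonality to ξ on the
bond. -/
theorem psi_update_update (hq0 : 0 < q) (n : ℕ) (α : Conf Λ) {x y : ↥Λ}
    (hxy : IsBond x.1 y.1) :
    psi q Λ n (Function.update (Function.update α x 0) y 1) =
      q * psi q Λ n (Function.update (Function.update α x 1) y 0) := by
  obtain ⟨i, hi⟩ := hxy
  have hh : height y.1 = height x.1 + 1 := by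
    rw [hi, height_add]
    fin_cases i <;> simp [height]
  have hne : x ≠ y := by
    rintro rfl; omega
  have hc : count (Function.update (Function.update α x 0) y 1) =
      count (Function.update (Function.update α x 1) y 0) := by
    have h := fun s t => prod_update_update (M := Multiplicative ℕ)
      (fun _ u => Multiplicative.ofAdd (u : ℕ)) α hne s t
    refine (h 0 1).trans (Eq.trans ?_ (h 1 0).symm)
    rw [mul_left_comm]
  have hw : weight q (Function.update (Function.update α x 0) y 1) =
      q * weight q (Function.update (Function.update α x 1) y 0) := by
    have h := fun s t => prod_update_update
      (fun z u => q ^ (height z.1 * ((u : ℕ) : ℤ))) α hne s t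
    rw [weight, weight, h 0 1, h 1 0, hh]
    simp only [Fin.val_zero, Fin.val_one, Nat.cast_zero, Nat.cast_one, mul_zero, mul_one,
      zpow_zero, zpow_add₀ hq0.ne', zpow_one, one_mul]
    ring
  rw [psi_apply, psi_apply, hc, hw]
  split_ifs
  · push_cast; rfl
  · simp

theorem bondOp_psi (hq0 : 0 < q) (n : ℕ) {x y : ↥Λ} (hxy : IsBond x.1 y.1) :
    bondOp q x y (psi q Λ n) = 0 := by
  ext α
  change (xi q (α x) (α y) : ℂ) * ∑ s : Fin 2, ∑ t : Fin 2,
    (xi q s t : ℂ) * psi q Λ n (Function.update (Function.update α x s) y t) = 0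
  simp only [Fin.sum_univ_two]
  rw [psi_update_update hq0 n α hxy]
  simp [xi]
  right
  ring

theorem psi_mem_groundSpace (hq0 : 0 < q) (n : ℕ) : psi q Λ n ∈ groundSpace q Λ := by
  rw [groundSpace, LinearMap.mem_ker]
  change hamiltonian q Λ (psi q Λ n) = 0
  rw [hamiltonian, sum_apply]
  refine Finset.sum_eq_zero fun x _ => ?_
  rw [sum_apply]
  refine Finset.sum_eq_zero fun y _ => ?_
  split_ifs with h
  · exact bondOp_psi hq0 n h
  · simp

theorem norm_canExp_le_gsNorm (hq0 : 0 < q) (A : Hilb Λ →L[ℂ] Hilb Λ) (n : ℕ) :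
    ‖canExp q Λ n A‖ ≤ gsNorm q A := by
  set ψ := psi q Λ n with hψ
  set P := (groundSpace q Λ).starProjection with hP
  have hPψ : P ψ = ψ := Submodule.starProjection_eq_self_iff.2 (psi_mem_groundSpace hq0 n)
  have e : inner ℂ ψ (A ψ) = inner ℂ ψ ((P ∘L A ∘L P) ψ) := by
    rw [ContinuousLinearMap.comp_apply, ContinuousLinearMap.comp_apply, hPψ,
      ← Submodule.inner_starProjection_left_eq_right]
    rw [← hP, hPψ]
  rw [canExp, expect, e, norm_div, inner_self_eq_norm_sq_to_K, norm_pow, RCLike.norm_ofReal,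
    abs_norm]
  refine div_le_of_le_mul₀ (sq_nonneg _) (norm_nonneg _) ?_
  refine (norm_inner_le_norm _ _).trans ?_
  rw [sq, mul_comm, ← mul_assoc]
  exact mul_le_mul_of_nonneg_right (ContinuousLinearMap.le_opNorm _ _) (norm_nonneg _)

theorem norm_canExp_le_gsSup (A : Hilb Λ →L[ℂ] Hilb Λ) {n : ℕ} (hn : n < Λ.card + 1) :
    ‖canExp q Λ n A‖ ≤ gsSup q A :=
  le_ciSup (f := fun n : Fin (Λ.card + 1) => ‖canExp q Λ n A‖) (Set.finite_range _).bddAbove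
    ⟨n, hn⟩

end groundStates

/-! ### Equivalence of ensembles -/

section equivalence

variable {q : ℝ}

theorem isChemPot_iff (hq0 : 0 < q) {L : ℕ} {ρ μ : ℝ} :
    IsChemPot q L ρ μ ↔ stickDensity q L μ = ρ * (L + 1) := by
  rw [IsChemPot, gcExp_numberOp hq0, sum_stick L (occupation q μ), Complex.ofReal_inj]
  rfl

/-- A bound on the difference of the particle number distributions bounds the difference of the
canonical and grand canonical expectations. -/
theorem norm_canExp_sub_gcExp_le (hq0 : 0 < q) {Λ₀ Λ : Finset Site} (h : Λ₀ ⊆ Λ)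
    {A : Hilb Λ₀ →L[ℂ] Hilb Λ₀} (hA : Commute (ampliation h A) (totalSpinZ Λ)) (μ : ℝ) {n : ℕ}
    (hn : n ≤ Λ.card) {M ε : ℝ} (hM : ∀ k < Λ₀.card + 1, ‖canExp q Λ₀ k A‖ ≤ M)
    (hε : ∑ k ∈ Finset.range (Λ₀.card + 1), (numberPoly q Λ₀ μ).coeff k *
        |(X ^ k * numberPoly q (Λ \ Λ₀) μ).coeff n - (numberPoly q Λ μ).coeff n| ≤
      ε * (numberPoly q Λ μ).coeff n) :
    ‖canExp q Λ n (ampliation h A) - gcExp q Λ₀ μ A‖ ≤ ε * M := by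
  have hp : ∀ x : Site, 0 < occupation q μ (height x) ∧ occupation q μ (height x) < 1 :=
    fun x => occupation_pos hq0 μ _
  have hf : 0 < (numberPoly q Λ μ).coeff n := coeff_bernoulliPoly_pos _ _ hp hn
  have hM0 : 0 ≤ M := (norm_nonneg _).trans (hM 0 (Nat.succ_pos _))
  refine le_of_mul_le_mul_left ?_ hf
  have e : ((numberPoly q Λ μ).coeff n : ℂ) *
      (canExp q Λ n (ampliation h A) - gcExp q Λ₀ μ A) =
      ∑ k ∈ Finset.range (Λ₀.card + 1), ((numberPoly q Λ₀ μ).coeff k *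
        ((X ^ k * numberPoly q (Λ \ Λ₀) μ).coeff n - (numberPoly q Λ μ).coeff n) : ℝ) *
          canExp q Λ₀ k A := by
    rw [mul_sub, canExp_ampliation_mul hq0 h, gcExp_eq_sum hq0 h hA, Finset.mul_sum,
      ← Finset.sum_sub_distrib]
    refine Finset.sum_congr rfl fun k _ => ?_
    push_cast
    ring
  have e' := congrArg norm e
  rw [norm_mul, Complex.norm_real, Real.norm_of_nonneg hf.le] at e'
  rw [e']
  calc _ ≤ ∑ k ∈ Finset.range (Λ₀.card + 1), (numberPoly q Λ₀ μ).coeff k *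
        |(X ^ k * numberPoly q (Λ \ Λ₀) μ).coeff n - (numberPoly q Λ μ).coeff n| * M := by
        refine (norm_sum_le _ _).trans (Finset.sum_le_sum fun k hk => ?_)
        have hk0 : 0 ≤ (numberPoly q Λ₀ μ).coeff k := coeff_bernoulliPoly_nonneg _ _ hp k
        rw [norm_mul, Complex.norm_real, norm_mul, Real.norm_of_nonneg hk0, Real.norm_eq_abs]
        exact mul_le_mul_of_nonneg_left (hM k (Finset.mem_range.1 hk)) (by positivity)
    _ ≤ ε * (numberPoly q Λ μ).coeff n * M := by
        rw [← Finset.sum_mul]; exact mul_le_mul_of_nonneg_right hε hM0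
    _ = _ := by ring

theorem le_eps {A₀ A : ℕ} (hB : (A₀ : ℝ) < A) :
    4 * A₀ / (q ^ 2 * √((A : ℝ) - A₀) - 2 * A₀) ≤ eps q A₀ A := by
  have : 0 < (A : ℝ) - A₀ := sub_pos.2 hB
  rw [eps]
  refine le_add_of_nonneg_left (div_nonneg ?_ (by linarith))
  positivity

/-- The particle number distributions in the canonical and grand canonical states are close. -/
theorem sum_coeff_numberPoly_le_eps (hq0 : 0 < q) (hq1 : q < 1) {L : ℕ}
    {Γ₀ Γ : Finset Site} (hΓ₀ : ∀ x ∈ Γ₀, height x = 0) (hΓ : ∀ x ∈ Γ, height x = 0)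
    (hsub : cylinder Γ₀ L ⊆ cylinder Γ L) {n : ℕ} (hn : n < (cylinder Γ L).card) {μ : ℝ}
    (hμ : Γ.card * stickDensity q L μ = n)
    (hA : 2 * (Γ₀.card : ℝ) < q ^ 2 * √((Γ.card : ℝ) - Γ₀.card)) :
    ∑ k ∈ Finset.range ((cylinder Γ₀ L).card + 1), (numberPoly q (cylinder Γ₀ L) μ).coeff k *
        |(X ^ k * numberPoly q (cylinder Γ L \ cylinder Γ₀ L) μ).coeff n -
          (numberPoly q (cylinder Γ L) μ).coeff n| ≤
      eps q Γ₀.card Γ.card * (numberPoly q (cylinder Γ L) μ).coeff n := by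
  have hp : ∀ x : Site, 0 < occupation q μ (height x) ∧ occupation q μ (height x) < 1 :=
    fun x => occupation_pos hq0 μ _
  have hf : 0 ≤ (numberPoly q (cylinder Γ L) μ).coeff n := coeff_bernoulliPoly_nonneg _ _ hp n
  set a : ℝ := (Γ₀.card : ℝ) with ha
  set b : ℝ := (Γ.card : ℝ) - a with hb
  have ha0 : 0 ≤ a := Nat.cast_nonneg _
  have hq2 : q ^ 2 < 1 := pow_lt_one₀ hq0.le hq1 two_ne_zero
  -- For A ≤ A₀ the real square root takes the value 0, which contradicts `hA`; thus `hA` already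
  -- forces A₀ < A.
  have hsb : 0 < √b := by
    by_contra hc
    have h0 : √b = 0 := le_antisymm (not_lt.1 hc) (Real.sqrt_nonneg _)
    rw [h0, mul_zero] at hA
    linarith
  have hb0 : 0 < b := Real.sqrt_pos.1 hsb
  have heps := le_eps (q := q) (A₀ := Γ₀.card) (A := Γ.card) (sub_pos.1 hb0)
  rw [← ha, ← hb] at heps
  have hden : 0 < q ^ 2 * √b - 2 * a := by linarith
  have hqb : q ^ 2 * √b ≤ √b := mul_le_of_le_one_left hsb.le hq2.le
  -- In the first case 4a / (q²√b - 2a) ≥ 2, so the crude bound is enough. In the second, 16a ≤ 16a²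
  -- ≤ b gives the variance ratio required by the sharp bound.
  rcases le_or_gt (√b) (4 * a) with hsmall | hlarge
  · refine (sum_coeff_mul_abs_sub_le_two _ _ hp hsub n).trans
      (mul_le_mul_of_nonneg_right (le_trans ?_ heps) hf)
    rw [le_div_iff₀ hden]
    linarith
  · set v := ∑ m ∈ stickHeights L, occupation q μ m * (1 - occupation q μ m) with hv
    have hv0 : 0 < v := Finset.sum_pos (fun m _ =>
      mul_pos (occupation_pos hq0 μ m).1 (sub_pos.2 (occupation_pos hq0 μ m).2))
      ⟨0, zero_mem_stickHeights L⟩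
    have hV₀ := sum_cylinder hΓ₀ L fun m => occupation q μ m * (1 - occupation q μ m)
    have hV := sum_cylinder hΓ L fun m => occupation q μ m * (1 - occupation q μ m)
    have hV₁ := Finset.sum_sdiff (f := fun x =>
      occupation q μ (height x) * (1 - occupation q μ (height x))) hsub
    rw [hV₀, hV] at hV₁
    have haa : a ≤ a ^ 2 := by
      rw [ha]; exact_mod_cast Nat.le_self_pow two_ne_zero _
    have hba : 16 * a ≤ b := by
      have h1 : (4 * a) ^ 2 ≤ √b ^ 2 := by gcongr
      rw [Real.sq_sqrt hb0.le] at h1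
      linarith
    have hmean := sum_cylinder hΓ L (occupation q μ)
    have h2 := sum_coeff_mul_abs_sub_le (cylinder Γ L) (fun x => occupation q μ (height x)) hp
      hsub hn (by rw [hmean]; exact hμ) (V₀ := a * v) (V₁ := b * v) hV₀
      (by rw [hb]; linarith) (by positivity)
      (by rw [← mul_assoc]; exact mul_le_mul_of_nonneg_right hba hv0.le)
    refine h2.trans (mul_le_mul_of_nonneg_right (le_trans ?_ heps) hf)
    rw [mul_div_mul_right _ _ hv0.ne', Real.sqrt_div ha0, mul_div_assoc']
    -- This holds because a is a natural number; together with q²√b - 2a ≤ √b it compares 4√a/√b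
    -- with the error term.
    have h3 : √a ≤ a := Real.sqrt_le_iff.2 ⟨ha0, haa⟩
    exact div_le_div₀ (by positivity) (by linarith) hden (by linarith)

end equivalence

end

end XXZ

theorem mainTheorem7 (q : ℝ) (hq0 : 0 < q) (hq1 : q < 1) (L : ℕ) (hL : Even L)
    (Γ₀ Γ : Finset XXZ.Site)
    (hΓ₀ : ∀ x ∈ Γ₀, XXZ.height x = 0) (hΓ : ∀ x ∈ Γ, XXZ.height x = 0)
    (hsub : XXZ.cylinder Γ₀ L ⊆ XXZ.cylinder Γ L)
    (n : ℕ) (hn0 : 0 < n) (hn : n < (XXZ.cylinder Γ L).card)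
    (ρ : ℝ) (hρ : ρ = (n : ℝ) / (XXZ.cylinder Γ L).card) :
    (∃! μ : ℝ, XXZ.IsChemPot q L ρ μ) ∧
    ∀ μ : ℝ, XXZ.IsChemPot q L ρ μ →
      (ρ = 1 / 2 → μ = 0) ∧
      (2 * (Γ₀.card : ℝ) < q ^ 2 * √((Γ.card : ℝ) - Γ₀.card) →
      ∀ X : XXZ.Hilb (XXZ.cylinder Γ₀ L) →L[ℂ] XXZ.Hilb (XXZ.cylinder Γ₀ L),
        Commute (XXZ.ampliation hsub X) (XXZ.totalSpinZ (XXZ.cylinder Γ L)) →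
        ‖XXZ.canExp q (XXZ.cylinder Γ L) n (XXZ.ampliation hsub X)
            - XXZ.gcExp q (XXZ.cylinder Γ₀ L) μ X‖
          ≤ XXZ.eps q Γ₀.card Γ.card * XXZ.gsSup q X ∧
        ‖XXZ.canExp q (XXZ.cylinder Γ L) n (XXZ.ampliation hsub X)
            - XXZ.gcExp q (XXZ.cylinder Γ₀ L) μ X‖
          ≤ XXZ.eps q Γ₀.card Γ.card * XXZ.gsNorm q X) := by
  have hcard : ((XXZ.cylinder Γ L).card : ℝ) = Γ.card * (L + 1) := by
    exact_mod_cast XXZ.card_cylinder hΓ hL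
  have hn0' : (0 : ℝ) < n := by exact_mod_cast hn0
  have hn' : (n : ℝ) < (XXZ.cylinder Γ L).card := by exact_mod_cast hn
  have hpos : (0 : ℝ) < (XXZ.cylinder Γ L).card := hn0'.trans hn'
  have hρ0 : 0 < ρ := by rw [hρ]; positivity
  have hρ1 : ρ < 1 := by rw [hρ]; exact (div_lt_one hpos).2 hn'
  have hL0 : (0 : ℝ) < L + 1 := by positivity
  have hinj := (XXZ.stickDensity_strictMono hq0 hq1 L).injective
  simp only [XXZ.isChemPot_iff hq0]
  refine ⟨?_, fun μ hμ => ⟨fun hhalf => ?_, fun hA X hX => ?_⟩⟩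
  · obtain ⟨μ, hμ⟩ := XXZ.exists_stickDensity_eq hq0 hq1 hL (c := ρ * (L + 1)) (by positivity)
      (by nlinarith)
    exact ⟨μ, hμ, fun ν hν => hinj (hν.trans hμ.symm)⟩
  · refine hinj (hμ.trans ?_)
    rw [XXZ.stickDensity_zero hq0 hL, hhalf]
    ring
  -- The stick equation, multiplied by the base size, says that the mean of N is the integer n, as
  -- the lower bound for P(N = n) requires.
  · have hmean : Γ.card * XXZ.stickDensity q L μ = n := by
      rw [hμ, mul_left_comm, ← hcard, hρ, div_mul_cancel₀ _ hpos.ne']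
    have hε := XXZ.sum_coeff_numberPoly_le_eps hq0 hq1 hΓ₀ hΓ hsub hn hmean hA
    exact ⟨XXZ.norm_canExp_sub_gcExp_le hq0 hsub hX μ hn.le
        (fun k hk => XXZ.norm_canExp_le_gsSup X hk) hε,
      XXZ.norm_canExp_sub_gcExp_le hq0 hsub hX μ hn.le
        (fun k _ => XXZ.norm_canExp_le_gsNorm hq0 X k) hε⟩
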